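/- Let $n\ge 0$, let $o$ be the origin of $\mathbb{C}^n$, and let $\mathcal{O}_o$ be the ring of germs at $o$ of holomorphic functions. A triple $(D,\varphi,F)$ is called admissible if $D\subseteq\mathbb{C}^n$ is a pseudoconvex domain containing $o$, $\varphi$ is a negative plurisubharmonic function on $D$ ($\varphi\not\equiv-\infty$) with $\varphi(o)=-\infty$, and $F$ is a holomorphic function on $D$. For $c\ge 0$ let $\mathcal{I}(c\varphi)_o$ be the ideal of all $(G,o)\in\mathcal{O}_o$ such that $|G|^2e^{-c\varphi}$ is integrable near $o$. Put $$c_o^F(\varphi)=\sup\{c\ge 0:(F,o)\in\mathcal{I}(c\varphi)_o\}\in[0,+\infty],\qquad \mathcal{I}_+(c\varphi)_o=\bigcup_{p>c}\mathcal{I}(p\varphi)_o\ \ (c<+\infty),\qquad \mathcal{I}_+(+\infty\cdot\varphi)_o=\{0\}.$$ Let $A^2(D)$ be the space of holomorphic functions $f$ on $D$ with $\|f\|_D^2=\int_D|f|^2<+\infty$. Let $\ell_1^{(n)}$ be the space of families $\xi=(\xi_\alpha)_{\alpha\in\mathbb{N}^n}$ of complex numbers with $\sum_\alpha|\xi_\alpha|\rho^{|\alpha|}<+\infty$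 for all $\rho>0$. For $f$ holomorphic near $o$ put $(\xi\cdot f)(o)=\sum_\alpha\xi_\alpha\frac{(D^\alpha f)(o)}{\alpha!}$, and let $$K_{\xi,D}(o)=\sup\{|(\xi\cdot f)(o)|^2: f\in A^2(D),\ \|f\|_D\le 1\}.$$ For an ideal $I$ of $\mathcal{O}_o$ let $\ell_I$ be the set of $\xi\in\ell_1^{(n)}\setminus\{0\}$ with $(\xi\cdot f)(o)=0$ for all $(f,o)\in I$, and define $$B(F,I,D)=\sup_{\xi\in\ell_I}\frac{|(\xi\cdot F)(o)|^2}{K_{\xi,D}(o)},\qquad C_{F,I}(D)=\inf\{\|\tilde F\|_D^2:\tilde F\in A^2(D),\ (\tilde F-F,o)\in I\},$$ with values in $[0,+\infty]$, where $\inf\emptyset=+\infty$, $\sup\emptyset=0$. Throughout, in quotients in $[0,+\infty]$, $0/0=0$, $a/0=+\infty$ for $a>0$, and $a/(+\infty)=0$ for $a<+\infty$. For an admissible triple $(D,\varphi,F)$ and $T\in[0,+\infty]$, let $\mathrm{E}(T;D,\varphi,F)$ be the statement: if $\int_D|F|^2e^{-\varphi}<+\infty$, then $(F,o)\in\mathcal{I}(p\varphi)_o$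 for every $p>1$ with $$\frac{p}{p-1}>\frac{\int_D|F|^2e^{-\varphi}}{T}.$$ Put $I=\mathcal{I}_+(c_o^F(\varphi)\varphi)_o$. Then: 1. For every admissible triple $(D,\varphi,F)$ the two thresholds coincide, $B(F,I,D)=C_{F,I}(D)$, and consequently $\mathrm{E}(B(F,I,D);D,\varphi,F)$ holds if and only if $\mathrm{E}(C_{F,I}(D);D,\varphi,F)$ holds. 2. The effectiveness result of strong openness through $\xi$-Bergman kernels (Bao–Guan), "$\mathrm{E}(B(F,I,D);D,\varphi,F)$ for all admissible $(D,\varphi,F)$ in $\mathbb{C}^n$", is equivalent to the one through minimal $L^2$ integrals (Guan), "$\mathrm{E}(C_{F,I}(D);D,\varphi,F)$ for all admissible $(D,\varphi,F)$ in $\mathbb{C}^n$". -/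

import Mathlib

open MeasureTheory Filter Topology
open scoped ENNReal

noncomputable section

namespace StrongOpenness

/-- Complex affine space `ℂⁿ` (only its topology, its analytic structure and its Lebesgue measure
`volume` are used below). -/
abbrev Cn (n : ℕ) : Type := Fin n → ℂ

variable {n : ℕ}

/-! ### Germs of holomorphic functions at the origin -/

/-- The ring `𝒪ₒ` of germs at the origin of holomorphic functions. -/
def holGermSubring (n : ℕ) : Subring (Germ (𝓝 (0 : Cn n)) ℂ) where
  carrier := {g | ∃ f : Cn n → ℂ, AnalyticAt ℂ f 0 ∧ (f : Germ (𝓝 (0 : Cn n)) ℂ) = g}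
  mul_mem' := by
    rintro _ _ ⟨f, hf, rfl⟩ ⟨g, hg, rfl⟩
    exact ⟨f * g, hf.mul hg, rfl⟩
  one_mem' := ⟨1, analyticAt_const, rfl⟩
  add_mem' := by
    rintro _ _ ⟨f, hf, rfl⟩ ⟨g, hg, rfl⟩
    exact ⟨f + g, hf.add hg, rfl⟩
  zero_mem' := ⟨0, analyticAt_const, rfl⟩
  neg_mem' := by
    rintro _ ⟨f, hf, rfl⟩
    exact ⟨-f, hf.neg, rfl⟩

/-- The ring `𝒪ₒ` as a type. -/
abbrev HolGerm (n : ℕ) : Type := holGermSubring n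

/-- The germ `(f, o)` of a function that is holomorphic near the origin. -/
def germ (f : Cn n → ℂ) (hf : AnalyticAt ℂ f 0) : HolGerm n :=
  ⟨(f : Germ (𝓝 (0 : Cn n)) ℂ), f, hf, rfl⟩

/-- `(f, o) ∈ I`: the function `f` is holomorphic near `o` and its germ belongs to `I`. -/
def GermMem (I : Ideal (HolGerm n)) (f : Cn n → ℂ) : Prop :=
  ∃ hf : AnalyticAt ℂ f 0, germ f hf ∈ I

/-! ### The Bergman space -/

/-- `‖f‖²_D = ∫_D |f|²`, with values in `[0, ∞]`. -/
def normSqOn (D : Set (Cn n)) (f : Cn n → ℂ) : ℝ≥0∞ :=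
  ∫⁻ z in D, ‖f z‖ₑ ^ 2

/-- `A²(D) = L²(D) ∩ 𝒪(D)` (the values of the functions outside `D` are irrelevant). -/
def bergmanSpace (D : Set (Cn n)) : Set (Cn n → ℂ) :=
  {f | AnalyticOnNhd ℂ f D ∧ normSqOn D f < ∞}

/-! ### `ξ`-Bergman kernels -/

/-- The partial derivative `∂f/∂z_j`. -/
def partialDeriv (j : Fin n) (f : Cn n → ℂ) : Cn n → ℂ :=
  fun z => fderiv ℂ f z (Pi.single j 1)

/-- The iterated derivative `D^α f = ∂^{|α|} f / ∂z₁^{α₁} ⋯ ∂zₙ^{αₙ}`. -/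
def multiDeriv (α : Fin n → ℕ) (f : Cn n → ℂ) : Cn n → ℂ :=
  (List.finRange n).foldr (fun j g => (partialDeriv j)^[α j] g) f

/-- The Taylor coefficient `(D^α f)(z) / α!` of `f` at `z`. -/
def taylorCoeff (α : Fin n → ℕ) (f : Cn n → ℂ) (z : Cn n) : ℂ :=
  multiDeriv α f z / ((∏ j, (α j).factorial : ℕ) : ℂ)

/-- `ℓ₁⁽ⁿ⁾`: the families `(ξ_α)` with `∑ |ξ_α| ρ^{|α|} < ∞` for all `ρ > 0`. -/
def ellOne (n : ℕ) : Set ((Fin n → ℕ) → ℂ) :=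
  {ξ | ∀ ρ : ℝ, 0 < ρ → Summable fun α => ‖ξ α‖ * ρ ^ (∑ j, α j)}

/-- `(ξ·f)(z) = ∑_α ξ_α (D^α f)(z) / α!` (the series converges absolutely when `ξ ∈ ℓ₁⁽ⁿ⁾` and
`f` is holomorphic near `z`). -/
def pairing (ξ : (Fin n → ℕ) → ℂ) (f : Cn n → ℂ) (z : Cn n) : ℂ :=
  ∑' α, ξ α * taylorCoeff α f z

/-- The `ξ`-Bergman kernel `K_{ξ,D}(z) = sup {|(ξ·f)(z)|² : f ∈ A²(D), ‖f‖_D ≤ 1}`. -/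
def bergmanKernel (ξ : (Fin n → ℕ) → ℂ) (D : Set (Cn n)) (z : Cn n) : ℝ≥0∞ :=
  ⨆ f ∈ {f | f ∈ bergmanSpace D ∧ normSqOn D f ≤ 1}, ‖pairing ξ f z‖ₑ ^ 2

/-- `ℓ_I`: the nonzero `ξ ∈ ℓ₁⁽ⁿ⁾` such that `(ξ·f)(o) = 0` for all `(f, o) ∈ I`. -/
def ellIdeal (I : Ideal (HolGerm n)) : Set ((Fin n → ℕ) → ℂ) :=
  {ξ | ξ ∈ ellOne n ∧ (∀ f, GermMem I f → pairing ξ f 0 = 0) ∧ ξ ≠ 0}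

/-- `B(F, I, D) = sup_{ξ ∈ ℓ_I} |(ξ·F)(o)|² / K_{ξ,D}(o)`. The quotient is taken in `[0, ∞]`, where
`0 / 0 = 0` and `a / 0 = ∞` for `a ≠ 0`. -/
def bergmanThreshold (F : Cn n → ℂ) (I : Ideal (HolGerm n)) (D : Set (Cn n)) : ℝ≥0∞ :=
  ⨆ ξ ∈ ellIdeal I, ‖pairing ξ F 0‖ₑ ^ 2 / bergmanKernel ξ D 0

/-! ### Minimal `L²` integrals -/

/-- `C_{F,I}(D) = inf {‖F̃‖²_D : F̃ ∈ A²(D), (F̃ - F, o) ∈ I}`, which is `∞` if there is no such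
`F̃`. -/
def minimalL2 (F : Cn n → ℂ) (I : Ideal (HolGerm n)) (D : Set (Cn n)) : ℝ≥0∞ :=
  ⨅ f ∈ {f | f ∈ bergmanSpace D ∧ GermMem I (f - F)}, normSqOn D f

/-! ### Plurisubharmonic functions and pseudoconvex domains -/

/-- `φ` is plurisubharmonic on the (connected) open set `D`: it has values in `[-∞, ∞)`, is not
identically `-∞`, is upper semicontinuous, and satisfies the sub-mean value inequality on every
closed disc `{z + ζ w : |ζ| ≤ 1}` in `D`. The mean of the upper semicontinuous function `φ` over the
boundary circle is the infimum of the means of its continuous majorants there. -/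
structure PSHOn (φ : Cn n → EReal) (D : Set (Cn n)) : Prop where
  lt_top : ∀ z ∈ D, φ z < ⊤
  exists_ne_bot : ∃ z ∈ D, φ z ≠ ⊥
  usc : UpperSemicontinuousOn φ D
  submean : ∀ z w : Cn n, (∀ ζ : ℂ, ‖ζ‖ ≤ 1 → z + ζ • w ∈ D) →
    ∀ h : ℂ → ℝ, Continuous h → (∀ ζ : ℂ, ‖ζ‖ = 1 → φ (z + ζ • w) ≤ (h ζ : EReal)) →
      φ z ≤ ((Real.circleAverage h 0 1 : ℝ) : EReal)

/-- A pseudoconvex domain: a connected nonempty open set with a continuous plurisubharmonic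
exhaustion function. -/
structure IsPseudoconvexDomain (D : Set (Cn n)) : Prop where
  isOpen : IsOpen D
  isConnected : IsConnected D
  exists_exhaustion : ∃ u : Cn n → ℝ, ContinuousOn u D ∧ PSHOn (fun z => (u z : EReal)) D ∧
    ∀ c : ℝ, IsCompact {z ∈ D | u z ≤ c}

/-! ### Multiplier ideals and jumping numbers -/

/-- The weight `e^{-cφ}` with values in `[0, ∞]`; for `c > 0` it is `∞` where `φ = -∞`. -/
def expWeight (c : ℝ) (φ : Cn n → EReal) (z : Cn n) : ℝ≥0∞ :=
  EReal.exp (-(c : EReal) * φ z)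

/-- `|f|² e^{-cφ}` is integrable near `o`. The integral is written against the measure
`e^{-cφ} dλ`; see `locIntegrable_iff` for the plain form. -/
def LocIntegrable (c : ℝ) (φ : Cn n → EReal) (f : Cn n → ℂ) : Prop :=
  ∃ U ∈ 𝓝 (0 : Cn n), ∫⁻ z in U, ‖f z‖ₑ ^ 2 ∂(volume.withDensity (expWeight c φ)) < ∞

theorem LocIntegrable.exists_open {c : ℝ} {φ : Cn n → EReal} {f : Cn n → ℂ}
    (hf : LocIntegrable c φ f) {P : Cn n → Prop} (hP : ∀ᶠ z in 𝓝 0, P z) :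
    ∃ V : Set (Cn n), IsOpen V ∧ (0 : Cn n) ∈ V ∧ (∀ z ∈ V, P z) ∧
      ∫⁻ z in V, ‖f z‖ₑ ^ 2 ∂(volume.withDensity (expWeight c φ)) < ∞ := by
  obtain ⟨U, hU, hfU⟩ := hf
  obtain ⟨V, hV, hVo, h0⟩ := mem_nhds_iff.1 (inter_mem hU hP)
  exact ⟨V, hVo, h0, fun z hz => (hV hz).2,
    lt_of_le_of_lt (lintegral_mono_set fun z hz => (hV hz).1) hfU⟩

theorem LocIntegrable.congr {c : ℝ} {φ : Cn n → EReal} {f g : Cn n → ℂ}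
    (hf : LocIntegrable c φ f) (hfg : f =ᶠ[𝓝 0] g) : LocIntegrable c φ g := by
  obtain ⟨V, hVo, h0, hP, hV⟩ := hf.exists_open hfg
  refine ⟨V, hVo.mem_nhds h0, ?_⟩
  rwa [setLIntegral_congr_fun (g := fun z => ‖f z‖ₑ ^ 2) hVo.measurableSet
    fun z hz => by simp [hP z hz]]

theorem LocIntegrable.add {c : ℝ} {φ : Cn n → EReal} {f g : Cn n → ℂ}
    (hfa : AnalyticAt ℂ f 0) (hf : LocIntegrable c φ f) (hg : LocIntegrable c φ g) :
    LocIntegrable c φ (f + g) := by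
  obtain ⟨W, hWo, h0W, -, hW⟩ := hg.exists_open (P := fun _ => True) (by simp)
  obtain ⟨V, hVo, h0, hP, hV⟩ := hf.exists_open
    (hfa.eventually_analyticAt.and (hWo.mem_nhds h0W))
  refine ⟨V, hVo.mem_nhds h0, ?_⟩
  have hfc : ContinuousOn f V := fun z hz => (hP z hz).1.continuousAt.continuousWithinAt
  have hm : AEMeasurable (fun z => 2 * ‖f z‖ₑ ^ 2)
      ((volume.withDensity (expWeight c φ)).restrict V) :=
    ((hfc.aemeasurable hVo.measurableSet).enorm.pow_const 2).const_mul 2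
  have hle : ∀ z, ‖(f + g) z‖ₑ ^ 2 ≤ 2 * ‖f z‖ₑ ^ 2 + 2 * ‖g z‖ₑ ^ 2 := by
    intro z
    simp only [Pi.add_apply, enorm_eq_nnnorm]
    norm_cast
    have h1 := nnnorm_add_le (f z) (g z)
    calc ‖f z + g z‖₊ ^ 2 ≤ (‖f z‖₊ + ‖g z‖₊) ^ 2 := by gcongr
      _ ≤ _ := by
        rw [← NNReal.coe_le_coe]
        push_cast
        nlinarith [sq_nonneg (‖f z‖ - ‖g z‖)]
  refine lt_of_le_of_lt (lintegral_mono hle) ?_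
  rw [lintegral_add_left' hm, lintegral_const_mul' _ _ (by simp), lintegral_const_mul' _ _ (by simp)]
  refine ENNReal.add_lt_top.2 ⟨ENNReal.mul_lt_top (by simp) hV, ENNReal.mul_lt_top (by simp) ?_⟩
  exact lt_of_le_of_lt (lintegral_mono_set fun z hz => (hP z hz).2) hW

theorem LocIntegrable.mul {c : ℝ} {φ : Cn n → EReal} {f g : Cn n → ℂ}
    (hfa : AnalyticAt ℂ f 0) (hg : LocIntegrable c φ g) : LocIntegrable c φ (f * g) := by
  have hb : ∀ᶠ z in 𝓝 (0 : Cn n), ‖f z‖₊ < ‖f 0‖₊ + 1 :=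
    hfa.continuousAt.nnnorm.eventually_lt_const (by simp)
  obtain ⟨V, hVo, h0, hP, hV⟩ := hg.exists_open hb
  refine ⟨V, hVo.mem_nhds h0, ?_⟩
  have hle : ∀ z ∈ V, ‖(f * g) z‖ₑ ^ 2 ≤ ((‖f 0‖₊ + 1 : NNReal) : ℝ≥0∞) ^ 2 * ‖g z‖ₑ ^ 2 := by
    intro z hz
    simp only [Pi.mul_apply, enorm_eq_nnnorm, nnnorm_mul]
    have := (hP z hz).le
    rw [ENNReal.coe_mul, mul_pow]
    gcongr
  refine lt_of_le_of_lt (setLIntegral_mono' hVo.measurableSet hle) ?_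
  rw [lintegral_const_mul' _ _ (by finiteness)]
  exact ENNReal.mul_lt_top (by finiteness) hV

/-- The multiplier ideal `𝓘(cφ)ₒ`: the germs `(G, o)` with `|G|² e^{-cφ}` integrable near `o`. -/
def multiplierIdeal (c : ℝ) (φ : Cn n → EReal) : Ideal (HolGerm n) where
  carrier := {g | ∃ f, AnalyticAt ℂ f 0 ∧ (f : Germ (𝓝 (0 : Cn n)) ℂ) = g ∧ LocIntegrable c φ f}
  zero_mem' := ⟨0, analyticAt_const, rfl, Set.univ, univ_mem, by simp⟩
  add_mem' := by
    rintro ⟨_, _⟩ ⟨_, _⟩ ⟨f, hf, rfl, hfi⟩ ⟨g, hg, rfl, hgi⟩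
    exact ⟨f + g, hf.add hg, rfl, hfi.add hf hgi⟩
  smul_mem' := by
    rintro ⟨_, f, hf, rfl⟩ ⟨_, _⟩ ⟨g, hg, rfl, hgi⟩
    exact ⟨f * g, hf.mul hg, rfl, hgi.mul hf⟩

theorem germMem_multiplierIdeal {c : ℝ} {φ : Cn n → EReal} {f : Cn n → ℂ} :
    GermMem (multiplierIdeal c φ) f ↔ AnalyticAt ℂ f 0 ∧ LocIntegrable c φ f := by
  constructor
  · rintro ⟨hf, g, hg, hgf, hgi⟩
    exact ⟨hf, hgi.congr (Germ.coe_eq.1 hgf)⟩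
  · rintro ⟨hf, hfi⟩
    exact ⟨hf, f, hf, rfl, hfi⟩

/-- For a plurisubharmonic weight, `LocIntegrable c φ f` says `∫_U |f|² e^{-cφ} < ∞` for some
neighbourhood `U` of `o`. -/
theorem locIntegrable_iff {c : ℝ} {φ : Cn n → EReal} {D : Set (Cn n)} (hD : IsOpen D)
    (h0 : (0 : Cn n) ∈ D) (hφ : PSHOn φ D) {f : Cn n → ℂ} (hf : AnalyticAt ℂ f 0) :
    LocIntegrable c φ f ↔ ∃ U ∈ 𝓝 (0 : Cn n), ∫⁻ z in U, ‖f z‖ₑ ^ 2 * expWeight c φ z < ∞ := by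
  have hmφ : Measurable (D.domRestrict φ) :=
    (upperSemicontinuousOn_iff_restrict.2 hφ.usc).measurable
  have hmul : Measurable fun x : EReal => -(c : EReal) * x := by
    rcases le_total 0 (-c) with h | h
    · refine Monotone.measurable fun x y hxy => mul_le_mul_of_nonneg_left hxy ?_
      exact_mod_cast h
    · refine Antitone.measurable fun x y hxy => ?_
      have : 0 ≤ (c : EReal) := by exact_mod_cast (by linarith : 0 ≤ c)
      simp only [EReal.neg_mul]
      exact EReal.neg_le_neg_iff.2 (mul_le_mul_of_nonneg_left hxy this)
  have hw : Measurable (D.domRestrict (expWeight c φ)) :=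
    EReal.measurable_exp.comp (hmul.comp hmφ)
  have key : ∀ V : Set (Cn n), IsOpen V → V ⊆ D → ContinuousOn f V →
      ∫⁻ z in V, ‖f z‖ₑ ^ 2 ∂(volume.withDensity (expWeight c φ)) =
        ∫⁻ z in V, ‖f z‖ₑ ^ 2 * expWeight c φ z := by
    intro V hV hVD hfc
    have hwV : AEMeasurable (expWeight c φ) (volume.restrict V) :=
      ((aemeasurable_restrict_iff_comap_subtype hD.measurableSet).2 hw.aemeasurable).mono_measure
        (Measure.restrict_mono hVD le_rfl)
    rw [restrict_withDensity hV.measurableSet, lintegral_withDensity_eq_lintegral_mul₀ hwV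
      ((hfc.aemeasurable hV.measurableSet).enorm.pow_const 2)]
    simp only [Pi.mul_apply, mul_comm]
  have hgood := hf.eventually_analyticAt.and (hD.mem_nhds h0)
  constructor
  · intro h
    obtain ⟨V, hVo, h0V, hP, hV⟩ := h.exists_open hgood
    refine ⟨V, hVo.mem_nhds h0V, ?_⟩
    rwa [← key V hVo (fun z hz => (hP z hz).2)
      fun z hz => (hP z hz).1.continuousAt.continuousWithinAt]
  · rintro ⟨U, hU, hfU⟩
    obtain ⟨V, hV, hVo, h0V⟩ := mem_nhds_iff.1 (inter_mem hU hgood)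
    refine ⟨V, hVo.mem_nhds h0V, ?_⟩
    rw [key V hVo (fun z hz => (hV hz).2.2)
      fun z hz => (hV hz).2.1.continuousAt.continuousWithinAt]
    exact lt_of_le_of_lt (lintegral_mono_set fun z hz => (hV hz).1) hfU

/-- The jumping number `c_o^F(φ) = sup {c ≥ 0 : (F, o) ∈ 𝓘(cφ)ₒ} ∈ [0, ∞]`. -/
def jumpingNumber (F : Cn n → ℂ) (φ : Cn n → EReal) : ℝ≥0∞ :=
  ⨆ c ∈ {c : ℝ | 0 ≤ c ∧ GermMem (multiplierIdeal c φ) F}, ENNReal.ofReal c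

/-- `𝓘₊(cφ)ₒ = ⋃_{p > c} 𝓘(pφ)ₒ`. For `φ ≤ 0` these ideals decrease as `p` grows, so that their
union is the ideal they generate, see `mem_multiplierIdealPlus`. For `c = ∞` this is the zero
ideal. -/
def multiplierIdealPlus (c : ℝ≥0∞) (φ : Cn n → EReal) : Ideal (HolGerm n) :=
  ⨆ p ∈ {p : ℝ | c < ENNReal.ofReal p}, multiplierIdeal p φ

theorem mem_multiplierIdealPlus {c : ℝ≥0∞} (hc : c ≠ ∞) {φ : Cn n → EReal} {D : Set (Cn n)}
    (hD : IsOpen D) (h0 : (0 : Cn n) ∈ D) (hφ : ∀ z ∈ D, φ z < 0) {g : HolGerm n} :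
    g ∈ multiplierIdealPlus c φ ↔ ∃ p : ℝ, c < ENNReal.ofReal p ∧ g ∈ multiplierIdeal p φ := by
  have anti : ∀ p q : ℝ, p ≤ q → multiplierIdeal q φ ≤ multiplierIdeal p φ := by
    rintro p q hpq x ⟨f, hf, hfx, hfi⟩
    obtain ⟨V, hVo, h0V, hP, hV⟩ := hfi.exists_open (hD.mem_nhds h0)
    refine ⟨f, hf, hfx, V, hVo.mem_nhds h0V, lt_of_le_of_lt ?_ hV⟩
    rw [restrict_withDensity hVo.measurableSet, restrict_withDensity hVo.measurableSet]
    refine lintegral_mono' ?_ le_rfl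
    refine withDensity_mono (ae_restrict_of_forall_mem hVo.measurableSet fun z hz => ?_)
    refine EReal.exp_monotone ?_
    simp only [EReal.neg_mul]
    refine EReal.neg_le_neg_iff.2 ?_
    rw [mul_comm, mul_comm (p : EReal)]
    have hz0 : 0 ≤ -φ z := by
      rw [EReal.le_neg, neg_zero]
      exact (hφ z (hP z hz)).le
    have := mul_le_mul_of_nonneg_left (EReal.coe_le_coe_iff.2 hpq) hz0
    rwa [EReal.neg_mul, EReal.neg_mul, EReal.neg_le_neg_iff] at this
  have hne : {p : ℝ | c < ENNReal.ofReal p}.Nonempty := by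
    refine ⟨c.toReal + 1, ?_⟩
    rw [Set.mem_ofPred_eq, ENNReal.lt_ofReal_iff_toReal_lt hc]
    linarith
  have := hne.to_subtype
  rw [multiplierIdealPlus, iSup_subtype', Submodule.mem_iSup_of_directed]
  · simp
  · rintro ⟨p, hp⟩ ⟨q, hq⟩
    rcases le_total p q with h | h
    · exact ⟨⟨p, hp⟩, le_rfl, anti p q h⟩
    · exact ⟨⟨q, hq⟩, anti q p h, le_rfl⟩

/-! ### The two effectiveness results -/

/-- The standing assumptions: `D ⊆ ℂⁿ` is a pseudoconvex domain containing the origin, `φ` is a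
negative plurisubharmonic function on `D` with `φ(o) = -∞`, and `F` is holomorphic on `D`. -/
structure IsAdmissible (D : Set (Cn n)) (φ : Cn n → EReal) (F : Cn n → ℂ) : Prop where
  pseudoconvex : IsPseudoconvexDomain D
  zero_mem : (0 : Cn n) ∈ D
  psh : PSHOn φ D
  neg : ∀ z ∈ D, φ z < 0
  pole : φ 0 = ⊥
  holomorphic : AnalyticOnNhd ℂ F D

/-- `∫_D |F|² e^{-φ}`. -/
def weightedIntegral (D : Set (Cn n)) (φ : Cn n → EReal) (F : Cn n → ℂ) : ℝ≥0∞ :=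
  ∫⁻ z in D, ‖F z‖ₑ ^ 2 * expWeight 1 φ z

/-- The effectiveness statement for `(D, φ, F)` with threshold `T`: if `∫_D |F|² e^{-φ} < ∞`, then
`(F, o) ∈ 𝓘(pφ)ₒ` for all `p > 1` with `p / (p - 1) > (∫_D |F|² e^{-φ}) / T`. -/
def EffectiveWith (T : ℝ≥0∞) (D : Set (Cn n)) (φ : Cn n → EReal) (F : Cn n → ℂ) : Prop :=
  weightedIntegral D φ F < ∞ → ∀ p : ℝ, 1 < p →
    weightedIntegral D φ F / T < ENNReal.ofReal (p / (p - 1)) → GermMem (multiplierIdeal p φ) F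

/-- The threshold `B(F, 𝓘₊(c_o^F(φ)φ)ₒ, D)`. -/
def thresholdB (D : Set (Cn n)) (φ : Cn n → EReal) (F : Cn n → ℂ) : ℝ≥0∞ :=
  bergmanThreshold F (multiplierIdealPlus (jumpingNumber F φ) φ) D

/-- The threshold `C_{F, 𝓘₊(c_o^F(φ)φ)ₒ}(D)`. -/
def thresholdC (D : Set (Cn n)) (φ : Cn n → EReal) (F : Cn n → ℂ) : ℝ≥0∞ :=
  minimalL2 F (multiplierIdealPlus (jumpingNumber F φ) φ) D

/-- Sharp effectiveness of strong openness in `ℂⁿ` through `ξ`-Bergman kernels. -/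
def BergmanEffectiveness (n : ℕ) : Prop :=
  ∀ (D : Set (Cn n)) (φ : Cn n → EReal) (F : Cn n → ℂ), IsAdmissible D φ F →
    EffectiveWith (thresholdB D φ F) D φ F

/-- Sharp effectiveness of strong openness in `ℂⁿ` through minimal `L²` integrals. -/
def MinimalL2Effectiveness (n : ℕ) : Prop :=
  ∀ (D : Set (Cn n)) (φ : Cn n → EReal) (F : Cn n → ℂ), IsAdmissible D φ F →
    EffectiveWith (thresholdC D φ F) D φ F

end StrongOpenness

end

open MeasureTheory Filter Topology
open scoped ENNReal

noncomputable section

namespace StrongOpenness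

variable {n : ℕ}

/-! The equality of thresholds holds for every ideal `I` of `𝒪ₒ`, and everything else follows from
it. One inequality is duality in the easy direction: if `f` competes in the minimal `L²` integral,
then every `ξ ∈ ℓ_I` gives `f` and `F` the same pairing, and the definition of the kernel with
homogeneity bounds the quotient by `‖f‖²` (`bergmanThreshold_le_minimalL2`).

For the other, let `B` be the Bergman threshold, assumed finite, and consider in `ℂ^(ℕⁿ)`, with
coefficientwise convergence, the convex circled set of jets of `f + g` with `‖f‖² ≤ B` and `g ∈ I`.
If the jet of `F` were outside its closure, Hahn–Banach would give a continuous functional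
separating them. Such a functional involves finitely many coefficients, so it is the pairing with
some `ξ ∈ ℓ₁`; it kills the subspace `I`, and the separation says `|ξ·F|² > B K_ξ`, against the
definition of `B` (`jet_mem_closure_jetSet`).

So `F` is a limit, coefficient by coefficient, of `f_k + g_k`. Montel's theorem yields a limit `f'`
of a subsequence of the `f_k`, with `‖f'‖² ≤ B` by Fatou (`exists_subseq_tendsto_of_normSqOn_le`).
Then `f' - F` is the coefficientwise limit of `-g_k ∈ I`, and it belongs to `I` because ideals of
convergent power series are closed for this topology. Hence `f'` is a competitor with norm at most
`B`.

The closedness is the algebraic core. Exponents are totally ordered by an integer code, and division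
with remainder by an ideal (`IsConvIdeal.exists_division`) is solved by a Neumann series in a
weighted `ℓ¹` norm; the lowest exponent of a nonzero remainder would be an initial exponent of the
ideal, which is excluded. -/

/-! ### Convergent power series in several variables -/

/-- The monomial `z^α`. -/
def mon (α : Fin n →₀ ℕ) (z : Cn n) : ℂ := ∏ j, z j ^ α j

theorem mon_add (α β : Fin n →₀ ℕ) (z : Cn n) : mon (α + β) z = mon α z * mon β z := by
  simp [mon, pow_add, Finset.prod_mul_distrib]

theorem mon_zero_left (z : Cn n) : mon 0 z = 1 := by simp [mon]

theorem mon_single (j : Fin n) (k : ℕ) (z : Cn n) : mon (Finsupp.single j k) z = z j ^ k := by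
  rw [mon, Finset.prod_eq_single j]
  · simp
  · intro i _ hi
    simp [hi.symm]
  · simp

theorem norm_mon_le {ρ : ℝ} {z : Cn n} (hz : ‖z‖ ≤ ρ) (α : Fin n →₀ ℕ) :
    ‖mon α z‖ ≤ ρ ^ α.degree := by
  rw [mon, norm_prod, Finsupp.degree_eq_sum, ← Finset.prod_pow_eq_pow_sum]
  gcongr with j
  rw [norm_pow]
  gcongr
  exact (norm_le_pi_norm z j).trans hz

theorem mon_zero_right {α : Fin n →₀ ℕ} (hα : α ≠ 0) : mon α (0 : Cn n) = 0 := by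
  obtain ⟨j, hj⟩ := Finsupp.ne_iff.1 hα
  exact Finset.prod_eq_zero (Finset.mem_univ j) (by simpa using hj)

/-- The sum of a power series. -/
def sumSeries (a : MvPowerSeries (Fin n) ℂ) (z : Cn n) : ℂ := ∑' α, a.coeff α * mon α z

/-- Absolute convergence at the polyradius `(ρ, …, ρ)`. -/
def ConvAt (ρ : ℝ) (a : MvPowerSeries (Fin n) ℂ) : Prop :=
  Summable fun α : Fin n →₀ ℕ => ‖a.coeff α‖ * ρ ^ α.degree

/-- Convergence near the origin. -/
def Conv (a : MvPowerSeries (Fin n) ℂ) : Prop := ∃ ρ : ℝ, 0 < ρ ∧ ConvAt ρ a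

theorem ConvAt.mono {ρ σ : ℝ} {a : MvPowerSeries (Fin n) ℂ} (h : ConvAt ρ a) (hσ : 0 ≤ σ)
    (hσρ : σ ≤ ρ) : ConvAt σ a :=
  Summable.of_nonneg_of_le (fun _ => by positivity) (fun _ => by gcongr) h

theorem ConvAt.summable_norm {ρ : ℝ} {a : MvPowerSeries (Fin n) ℂ} (h : ConvAt ρ a) {z : Cn n}
    (hz : ‖z‖ ≤ ρ) : Summable fun α => ‖a.coeff α * mon α z‖ := by
  refine Summable.of_nonneg_of_le (fun _ => norm_nonneg _) (fun α => ?_) h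
  rw [norm_mul]
  gcongr
  exact norm_mon_le hz α

theorem ConvAt.hasSum {ρ : ℝ} {a : MvPowerSeries (Fin n) ℂ} (h : ConvAt ρ a) {z : Cn n}
    (hz : ‖z‖ ≤ ρ) : HasSum (fun α => a.coeff α * mon α z) (sumSeries a z) :=
  (h.summable_norm hz).of_norm.hasSum

theorem sumSeries_zero_right (a : MvPowerSeries (Fin n) ℂ) : sumSeries a 0 = a.coeff 0 := by
  rw [sumSeries, tsum_eq_single 0]
  · simp [mon_zero_left]
  · intro α hα
    simp [mon_zero_right hα]

/-- Writing `z^α` as a product of `k` coordinates gives a multilinear form. Each projection has norm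
at most one for the sup norm, which gives the bound. -/
theorem exists_multilinear_mon (k : ℕ) (α : Fin n →₀ ℕ) (hα : α.degree = k) :
    ∃ m : ContinuousMultilinearMap ℂ (fun _ : Fin k => Cn n) ℂ,
      ‖m‖ ≤ 1 ∧ ∀ z, m (fun _ => z) = mon α z := by
  have key : ∃ i : Fin k → Fin n, ∀ z : Cn n, ∏ l, z (i l) = mon α z := by
    induction k generalizing α with
    | zero =>
      obtain rfl := (Finsupp.degree_eq_zero_iff α).1 hα
      exact ⟨Fin.elim0, fun z => by simp [mon_zero_left]⟩
    | succ k ih =>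
      have hne : α ≠ 0 := by
        rintro rfl
        simp at hα
      obtain ⟨j, hj⟩ := Finsupp.ne_iff.1 hne
      have hle : Finsupp.single j 1 ≤ α := by
        rw [Finsupp.single_le_iff]
        exact Nat.one_le_iff_ne_zero.2 hj
      obtain ⟨β, rfl⟩ := exists_add_of_le hle
      rw [map_add, Finsupp.degree_single] at hα
      obtain ⟨i, hi⟩ := ih β (by omega)
      refine ⟨Fin.cons j i, fun z => ?_⟩
      rw [Fin.prod_univ_succ, mon_add, mon_single]
      simp [hi]
  obtain ⟨i, hi⟩ := key
  refine ⟨(ContinuousMultilinearMap.mkPiAlgebraFin ℂ k ℂ).compContinuousLinearMap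
    fun l => ContinuousLinearMap.proj (i l), ?_, fun z => ?_⟩
  · refine (ContinuousMultilinearMap.norm_compContinuousLinearMap_le _ _).trans ?_
    rw [ContinuousMultilinearMap.norm_mkPiAlgebraFin, one_mul]
    refine Finset.prod_le_one (fun _ _ => norm_nonneg _) fun l _ => ?_
    refine ContinuousLinearMap.opNorm_le_bound _ zero_le_one fun z => ?_
    simpa using norm_le_pi_norm z (i l)
  · simp [← hi, List.prod_ofFn]

/-- Grouping the monomials by degree turns the series over exponents into a series of homogeneous
polynomials; only finitely many exponents share a degree. -/
theorem ConvAt.hasFPowerSeriesOnBall {ρ : ℝ} (hρ : 0 < ρ) {a : MvPowerSeries (Fin n) ℂ}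
    (h : ConvAt ρ a) :
    ∃ p, HasFPowerSeriesOnBall (𝕜 := ℂ) (sumSeries a) p 0 (ENNReal.ofReal ρ) := by
  have hfin (k : ℕ) := Finsupp.finite_of_degree_eq (σ := Fin n) k
  have hex : ∀ (k : ℕ) (α : Fin n →₀ ℕ),
      ∃ m : ContinuousMultilinearMap ℂ (fun _ : Fin k => Cn n) ℂ,
        ‖m‖ ≤ 1 ∧ (α.degree = k → ∀ z, m (fun _ => z) = mon α z) := by
    intro k α
    by_cases hα : α.degree = k
    · obtain ⟨m, h1, h2⟩ := exists_multilinear_mon k α hα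
      exact ⟨m, h1, fun _ => h2⟩
    · exact ⟨0, by simp, fun h => absurd h hα⟩
  choose m hm1 hm2 using hex
  have hfib : ∀ {G : Type} [AddCommGroup G] [TopologicalSpace G] [T2Space G]
      (f : (Fin n →₀ ℕ) → G) (k : ℕ),
      ∑' b : ↑(Finsupp.degree ⁻¹' {k} : Set (Fin n →₀ ℕ)), f b = ∑ α ∈ (hfin k).toFinset, f α := by
    intro G _ _ _ f k
    have := Finset.tsum_subtype' (hfin k).toFinset f
    rw [← this, (hfin k).coe_toFinset]
    rfl
  refine ⟨fun k => ∑ α ∈ (hfin k).toFinset, a.coeff α • m k α, ?_, by simpa, ?_⟩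
  · have hs : Summable fun k => ∑ α ∈ (hfin k).toFinset, ‖a.coeff α‖ * ρ ^ α.degree := by
      have := (Summable.hasSum h).tsum_fiberwise (Finsupp.degree (σ := Fin n) (R := ℕ))
      simp only [hfib (fun α => ‖a.coeff α‖ * ρ ^ α.degree)] at this
      exact this.summable
    have : ENNReal.ofReal ρ = ((ρ.toNNReal : NNReal) : ℝ≥0∞) := rfl
    rw [this]
    refine FormalMultilinearSeries.le_radius_of_summable_norm _
      (Summable.of_nonneg_of_le (fun k => by positivity) (fun k => ?_) hs)
    rw [Real.coe_toNNReal _ hρ.le]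
    calc _ ≤ (∑ α ∈ (hfin k).toFinset, ‖a.coeff α‖) * ρ ^ k := by
          gcongr
          refine (norm_sum_le _ _).trans (Finset.sum_le_sum fun α _ => ?_)
          rw [norm_smul]
          exact mul_le_of_le_one_right (norm_nonneg _) (hm1 k α)
      _ = _ := by
          rw [Finset.sum_mul]
          refine Finset.sum_congr rfl fun α hα => ?_
          have : α.degree = k := by simpa using hα
          rw [this]
  · intro y hy
    have hy' : ‖y‖ ≤ ρ := by
      rw [Metric.mem_eball, edist_zero_right, ← ofReal_norm] at hy
      exact ((ENNReal.ofReal_lt_ofReal_iff hρ).1 hy).le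
    have := (h.hasSum hy').tsum_fiberwise (Finsupp.degree (σ := Fin n) (R := ℕ))
    simp only [hfib (fun α => a.coeff α * mon α y)] at this
    rw [zero_add]
    convert! this using 2 with k
    rw [sum_apply]
    refine Finset.sum_congr rfl fun α hα => ?_
    rw [smul_apply, hm2 k α (by simpa using hα), smul_eq_mul]

theorem ConvAt.analyticOnNhd {ρ : ℝ} {a : MvPowerSeries (Fin n) ℂ}
    (h : ConvAt ρ a) : AnalyticOnNhd ℂ (sumSeries a) (Metric.ball 0 ρ) := by
  rcases le_or_gt ρ 0 with hρ | hρ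
  · rw [Metric.ball_eq_empty.2 hρ]
    exact fun _ h => h.elim
  obtain ⟨p, hp⟩ := h.hasFPowerSeriesOnBall hρ
  have := hp.analyticOnNhd
  rwa [Metric.eball_ofReal] at this

theorem Conv.analyticAt {a : MvPowerSeries (Fin n) ℂ} (h : Conv a) :
    AnalyticAt ℂ (sumSeries a) 0 := by
  obtain ⟨ρ, hρ, h⟩ := h
  exact h.analyticOnNhd 0 (Metric.mem_ball_self hρ)

theorem Conv.add {a b : MvPowerSeries (Fin n) ℂ} (ha : Conv a) (hb : Conv b) : Conv (a + b) := by
  obtain ⟨ρ, hρ, ha⟩ := ha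
  obtain ⟨σ, hσ, hb⟩ := hb
  have hm : 0 < min ρ σ := lt_min hρ hσ
  refine ⟨min ρ σ, hm, Summable.of_nonneg_of_le (fun _ => by positivity) (fun α => ?_)
    ((ha.mono hm.le (min_le_left _ _)).add (hb.mono hm.le (min_le_right _ _)))⟩
  rw [← add_mul, map_add]
  gcongr
  exact norm_add_le _ _

theorem conv_zero : Conv (0 : MvPowerSeries (Fin n) ℂ) :=
  ⟨1, one_pos, by simp [ConvAt]⟩

theorem Conv.smul {a : MvPowerSeries (Fin n) ℂ} (ha : Conv a) (c : ℂ) : Conv (c • a) := by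
  obtain ⟨ρ, hρ, ha⟩ := ha
  refine ⟨ρ, hρ, ?_⟩
  have := Summable.mul_left ‖c‖ ha
  simpa [ConvAt, mul_assoc] using this

theorem Conv.eventually_hasSum {a : MvPowerSeries (Fin n) ℂ} (ha : Conv a) :
    ∀ᶠ z in 𝓝 (0 : Cn n), HasSum (fun α => a.coeff α * mon α z) (sumSeries a z) := by
  obtain ⟨ρ, hρ, ha⟩ := ha
  filter_upwards [Metric.closedBall_mem_nhds (0 : Cn n) hρ] with z hz
  exact ha.hasSum (by simpa using hz)

theorem Conv.sumSeries_add {a b : MvPowerSeries (Fin n) ℂ} (ha : Conv a) (hb : Conv b) :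
    sumSeries (a + b) =ᶠ[𝓝 0] sumSeries a + sumSeries b := by
  filter_upwards [ha.eventually_hasSum, hb.eventually_hasSum] with z h1 h2
  simpa [sumSeries, add_mul] using (h1.add h2).tsum_eq

theorem sumSeries_smul (c : ℂ) (a : MvPowerSeries (Fin n) ℂ) :
    sumSeries (c • a) = c • sumSeries a := by
  funext z
  simp [sumSeries, mul_assoc, tsum_mul_left]

theorem summable_sum_antidiagonal_mul {f g : (Fin n →₀ ℕ) → ℝ} (hf : Summable f)
    (hg : Summable g) (hf0 : 0 ≤ f) (hg0 : 0 ≤ g) :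
    Summable fun γ => ∑ p ∈ Finset.HasAntidiagonal.antidiagonal γ, f p.1 * g p.2 :=
  summable_sum_mul_antidiagonal_of_summable_mul (hf.mul_of_nonneg hg hf0 hg0)

theorem Conv.mul {a b : MvPowerSeries (Fin n) ℂ} (ha : Conv a) (hb : Conv b) : Conv (a * b) := by
  obtain ⟨ρ, hρ, ha⟩ := ha
  obtain ⟨σ, hσ, hb⟩ := hb
  have hm : 0 < min ρ σ := lt_min hρ hσ
  refine ⟨min ρ σ, hm, Summable.of_nonneg_of_le (fun _ => by positivity) (fun γ => ?_)
    (summable_sum_antidiagonal_mul (ha.mono hm.le (min_le_left _ _))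
      (hb.mono hm.le (min_le_right _ _)) (fun _ => by positivity) (fun _ => by positivity))⟩
  rw [MvPowerSeries.coeff_mul]
  calc _ ≤ (∑ p ∈ Finset.HasAntidiagonal.antidiagonal γ, ‖a.coeff p.1 * b.coeff p.2‖) * min ρ σ ^ γ.degree := by
        gcongr
        exact norm_sum_le _ _
    _ = _ := by
        rw [Finset.sum_mul]
        refine Finset.sum_congr rfl fun p hp => ?_
        rw [← Finset.HasAntidiagonal.mem_antidiagonal.1 hp, map_add, pow_add, norm_mul]
        ring

theorem sumSeries_mul_of_summable (a b : MvPowerSeries (Fin n) ℂ) (z : Cn n)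
    (ha : Summable fun α => a.coeff α * mon α z) (hb : Summable fun α => b.coeff α * mon α z) :
    sumSeries (a * b) z = sumSeries a z * sumSeries b z := by
  have hab : Summable fun p : (Fin n →₀ ℕ) × (Fin n →₀ ℕ) =>
      a.coeff p.1 * mon p.1 z * (b.coeff p.2 * mon p.2 z) :=
    summable_mul_of_summable_norm (f := fun α => a.coeff α * mon α z)
      (g := fun α => b.coeff α * mon α z) ha.norm hb.norm
  have h := ha.tsum_mul_tsum_eq_tsum_sum_antidiagonal hb hab
  refine Eq.trans (tsum_congr fun γ => ?_) h.symm
  rw [MvPowerSeries.coeff_mul, Finset.sum_mul]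
  refine Finset.sum_congr rfl fun p hp => ?_
  have hp' : mon γ z = mon p.1 z * mon p.2 z := by
    rw [← mon_add, Finset.HasAntidiagonal.mem_antidiagonal.1 hp]
  rw [hp', mul_mul_mul_comm]

theorem Conv.sumSeries_mul {a b : MvPowerSeries (Fin n) ℂ} (ha : Conv a) (hb : Conv b) :
    sumSeries (a * b) =ᶠ[𝓝 0] sumSeries a * sumSeries b := by
  filter_upwards [ha.eventually_hasSum, hb.eventually_hasSum] with z h1 h2
  exact sumSeries_mul_of_summable a b z h1.summable h2.summable

/-! ### Termwise differentiation and Taylor coefficients -/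

/-- This pays for the factor that differentiation brings down: it is absorbed by shrinking the
radius from `ρ` to `σ`. -/
theorem succ_mul_pow_le {σ ρ : ℝ} (hσ : 0 ≤ σ) (hσρ : σ ≤ ρ) (k : ℕ) :
    (k + 1) * σ ^ k * (ρ - σ) ≤ ρ ^ (k + 1) := by
  induction k with
  | zero => simpa using hσ
  | succ k ih =>
    have h1 : σ ^ (k + 1) ≤ ρ ^ (k + 1) := by gcongr
    have h2 := mul_le_mul_of_nonneg_left ih hσ
    have h3 := mul_le_mul_of_nonneg_left h1 (sub_nonneg.2 hσρ)
    push_cast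
    calc _ = σ * ((k + 1) * σ ^ k * (ρ - σ)) + (ρ - σ) * σ ^ (k + 1) := by ring
      _ ≤ σ * ρ ^ (k + 1) + (ρ - σ) * ρ ^ (k + 1) := add_le_add h2 h3
      _ = _ := by ring

theorem mon_eq_mul_erase (j : Fin n) (α : Fin n →₀ ℕ) (z : Cn n) :
    mon α z = z j ^ α j * ∏ i ∈ Finset.univ.erase j, z i ^ α i :=
  (Finset.mul_prod_erase _ _ (Finset.mem_univ j)).symm

theorem mon_update (j : Fin n) (α : Fin n →₀ ℕ) (z : Cn n) (w : ℂ) :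
    mon α (Function.update z j w) = w ^ α j * ∏ i ∈ Finset.univ.erase j, z i ^ α i := by
  rw [mon_eq_mul_erase j, Function.update_self]
  congr 1
  refine Finset.prod_congr rfl fun i hi => ?_
  rw [Function.update_of_ne (Finset.ne_of_mem_erase hi)]

theorem partialDeriv_eq_of_hasDerivAt {f : Cn n → ℂ} {z : Cn n} (hf : DifferentiableAt ℂ f z)
    (j : Fin n) {f' : ℂ} (h : HasDerivAt (fun w => f (Function.update z j w)) f' (z j)) :
    partialDeriv j f z = f' := by
  have hz : Function.update z j (z j) = z := Function.update_eq_self j z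
  have h1 : HasDerivAt (fun w => Function.update z j w) (Pi.single j 1 : Cn n) (z j) :=
    hasDerivAt_update z j (z j)
  have h2 : HasFDerivAt f (fderiv ℂ f z) (Function.update z j (z j)) := by
    rw [hz]
    exact hf.hasFDerivAt
  exact (h2.comp_hasDerivAt (z j) h1).unique h

theorem ConvAt.pderiv {σ ρ : ℝ} {a : MvPowerSeries (Fin n) ℂ} (h : ConvAt ρ a) (hσ : 0 ≤ σ)
    (hσρ : σ < ρ) (j : Fin n) : ConvAt σ (MvPowerSeries.pderiv ℂ j a) := by
  have hinj : Function.Injective fun β : Fin n →₀ ℕ => β + Finsupp.single j 1 :=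
    add_left_injective _
  have hs := (Summable.mul_left (ρ - σ)⁻¹ h).comp_injective hinj
  refine Summable.of_nonneg_of_le (fun _ => by positivity) (fun β => ?_) hs
  have hd : (β + Finsupp.single j 1).degree = β.degree + 1 := by
    rw [map_add, Finsupp.degree_single]
  have hpos : 0 < ρ - σ := sub_pos.2 hσρ
  rw [MvPowerSeries.coeff_pderiv, Function.comp_apply, hd, norm_mul, inv_mul_eq_div,
    le_div_iff₀ hpos, mul_assoc, mul_assoc]
  gcongr
  have h1 := succ_mul_pow_le hσ hσρ.le β.degree
  have h2 : ‖(β j : ℂ) + 1‖ ≤ β.degree + 1 := by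
    refine (norm_add_le _ _).trans ?_
    simp only [Complex.norm_natCast, norm_one, add_le_add_iff_right]
    exact_mod_cast Finsupp.le_degree j β
  calc _ ≤ (β.degree + 1) * (σ ^ β.degree * (ρ - σ)) := by gcongr
    _ ≤ _ := by rwa [← mul_assoc]

/-- Only the `j`-th coordinate varies, so the one-variable theorem on termwise differentiation
applies on the disc of radius `σ`, the derivatives being dominated through `succ_mul_pow_le`. -/
theorem ConvAt.partialDeriv_sumSeries {ρ : ℝ} {a : MvPowerSeries (Fin n) ℂ} (h : ConvAt ρ a)
    {z : Cn n} (hz : ‖z‖ < ρ) (j : Fin n) :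
    partialDeriv j (sumSeries a) z = sumSeries (MvPowerSeries.pderiv ℂ j a) z := by
  obtain ⟨σ, hzσ, hσρ⟩ := exists_between hz
  have hσ : 0 < σ := (norm_nonneg z).trans_lt hzσ
  have hpos : 0 < ρ - σ := sub_pos.2 hσρ
  have hzi (i : Fin n) : ‖z i‖ ≤ σ := (norm_le_pi_norm z i).trans hzσ.le
  refine partialDeriv_eq_of_hasDerivAt
    (h.analyticOnNhd z (by simpa using hz)).differentiableAt j ?_
  have hmem : z j ∈ Metric.ball (0 : ℂ) σ := by
    simpa using (norm_le_pi_norm z j).trans_lt hzσ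
  have key := hasDerivAt_tsum_of_isPreconnected (𝕜 := ℂ)
    (g := fun (α : Fin n →₀ ℕ) w => a.coeff α * mon α (Function.update z j w))
    (g' := fun α w => a.coeff α * (α j * w ^ (α j - 1) *
      ∏ i ∈ Finset.univ.erase j, z i ^ α i))
    (u := fun α => (ρ - σ)⁻¹ * (‖a.coeff α‖ * ρ ^ α.degree))
    (Summable.mul_left _ h) (Metric.isOpen_ball (x := (0 : ℂ)) (ε := σ))
    (convex_ball _ _).isPreconnected ?_ ?_ hmem
    (by simpa using (h.hasSum hz.le).summable) hmem
  · convert! key using 1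
    have hinj : Function.Injective fun β : Fin n →₀ ℕ => β + Finsupp.single j 1 :=
      add_left_injective _
    -- The shift by `e_j` reaches every exponent with `α j ≠ 0`; the remaining terms have derivative
    -- zero.
    rw [← hinj.tsum_eq]
    · refine tsum_congr fun β => ?_
      rw [MvPowerSeries.coeff_pderiv, mon_eq_mul_erase j]
      have h1 : ∏ i ∈ Finset.univ.erase j, z i ^ (β + Finsupp.single j 1 : Fin n →₀ ℕ) i =
          ∏ i ∈ Finset.univ.erase j, z i ^ β i := by
        refine Finset.prod_congr rfl fun i hi => ?_
        simp [(Finset.ne_of_mem_erase hi).symm]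
      rw [h1]
      simp
      ring
    · intro α hα
      have hj : α j ≠ 0 := by
        intro h0
        simp [h0] at hα
      have hle : Finsupp.single j 1 ≤ α := by
        rw [Finsupp.single_le_iff]
        exact Nat.one_le_iff_ne_zero.2 hj
      exact ⟨α - Finsupp.single j 1, tsub_add_cancel_of_le hle⟩
  · intro α w _
    simp only [mon_update]
    exact ((hasDerivAt_pow _ _).mul_const _).const_mul _
  · intro α w hw
    have hw' : ‖w‖ ≤ σ := by simpa using (Metric.mem_ball.1 hw).le
    rcases Nat.eq_zero_or_pos (α j) with h0 | h0
    · simp only [h0, Nat.cast_zero, zero_mul, mul_zero, norm_zero]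
      have := (norm_nonneg z).trans hz.le
      positivity
    rw [norm_mul, inv_mul_eq_div, le_div_iff₀ hpos, mul_assoc]
    gcongr
    have hd : α.degree = α j + ∑ i ∈ Finset.univ.erase j, α i := by
      rw [Finsupp.degree_eq_sum, Finset.add_sum_erase _ _ (Finset.mem_univ j)]
    obtain ⟨k, hk⟩ : ∃ k, α.degree = k + 1 := ⟨α.degree - 1, by omega⟩
    have h1 := succ_mul_pow_le hσ.le hσρ.le k
    rw [hk]
    refine le_trans ?_ h1
    gcongr
    rw [norm_mul, norm_mul, norm_prod, Complex.norm_natCast, norm_pow]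
    calc (α j : ℝ) * ‖w‖ ^ (α j - 1) * ∏ i ∈ Finset.univ.erase j, ‖z i ^ α i‖
        ≤ (k + 1) * σ ^ (α j - 1) * ∏ i ∈ Finset.univ.erase j, σ ^ α i := by
          gcongr with i
          · exact_mod_cast (by omega : α j ≤ k + 1)
          · rw [norm_pow]
            gcongr
            exact hzi i
      _ = (k + 1) * σ ^ k := by
          rw [Finset.prod_pow_eq_pow_sum, mul_assoc, ← pow_add]
          congr 2
          omega

theorem Conv.pderiv {a : MvPowerSeries (Fin n) ℂ} (h : Conv a) (j : Fin n) :
    Conv (MvPowerSeries.pderiv ℂ j a) := by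
  obtain ⟨ρ, hρ, h⟩ := h
  exact ⟨ρ / 2, by positivity, h.pderiv (by positivity) (by linarith) j⟩

theorem Conv.partialDeriv_sumSeries {a : MvPowerSeries (Fin n) ℂ} (h : Conv a) (j : Fin n) :
    partialDeriv j (sumSeries a) =ᶠ[𝓝 0] sumSeries (MvPowerSeries.pderiv ℂ j a) := by
  obtain ⟨ρ, hρ, h⟩ := h
  filter_upwards [Metric.ball_mem_nhds (0 : Cn n) hρ] with z hz
  exact h.partialDeriv_sumSeries (by simpa using hz) j

theorem partialDeriv_congr {f g : Cn n → ℂ} {z : Cn n} (h : f =ᶠ[𝓝 z] g) (j : Fin n) :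
    partialDeriv j f =ᶠ[𝓝 z] partialDeriv j g := by
  filter_upwards [h.fderiv (𝕜 := ℂ)] with w hw
  simp [partialDeriv, hw]

theorem iterate_partialDeriv_congr {f g : Cn n → ℂ} {z : Cn n} (h : f =ᶠ[𝓝 z] g) (j : Fin n)
    (k : ℕ) : (partialDeriv j)^[k] f =ᶠ[𝓝 z] (partialDeriv j)^[k] g := by
  induction k generalizing f g with
  | zero => exact h
  | succ k ih => exact ih (partialDeriv_congr h j)

theorem foldr_partialDeriv_congr {f g : Cn n → ℂ} {z : Cn n} (h : f =ᶠ[𝓝 z] g) (α : Fin n → ℕ)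
    (l : List (Fin n)) : l.foldr (fun j g => (partialDeriv j)^[α j] g) f =ᶠ[𝓝 z]
      l.foldr (fun j g => (partialDeriv j)^[α j] g) g := by
  induction l with
  | nil => exact h
  | cons j l ih => exact iterate_partialDeriv_congr ih j _

theorem taylorCoeff_congr {f g : Cn n → ℂ} {z : Cn n} (h : f =ᶠ[𝓝 z] g) (α : Fin n → ℕ) :
    taylorCoeff α f z = taylorCoeff α g z := by
  rw [taylorCoeff, taylorCoeff, multiDeriv, multiDeriv,
    (foldr_partialDeriv_congr h α _).eq_of_nhds]

theorem Conv.iterate_partialDeriv {a : MvPowerSeries (Fin n) ℂ} (h : Conv a) (j : Fin n) (k : ℕ) :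
    Conv ((MvPowerSeries.pderiv ℂ j)^[k] a) ∧
      (partialDeriv j)^[k] (sumSeries a) =ᶠ[𝓝 0]
        sumSeries ((MvPowerSeries.pderiv ℂ j)^[k] a) := by
  induction k generalizing a with
  | zero => exact ⟨h, EventuallyEq.rfl⟩
  | succ k ih =>
    obtain ⟨h1, h2⟩ := ih (h.pderiv j)
    exact ⟨h1, (iterate_partialDeriv_congr (h.partialDeriv_sumSeries j) j k).trans h2⟩

theorem Conv.foldr_partialDeriv {a : MvPowerSeries (Fin n) ℂ} (h : Conv a) (α : Fin n → ℕ)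
    (l : List (Fin n)) :
    Conv (l.foldr (fun j g => (MvPowerSeries.pderiv ℂ j)^[α j] g) a) ∧
      l.foldr (fun j g => (partialDeriv j)^[α j] g) (sumSeries a) =ᶠ[𝓝 0]
        sumSeries (l.foldr (fun j g => (MvPowerSeries.pderiv ℂ j)^[α j] g) a) := by
  induction l with
  | nil => exact ⟨h, EventuallyEq.rfl⟩
  | cons j l ih =>
    obtain ⟨h1, h2⟩ := ih.1.iterate_partialDeriv j (α j)
    exact ⟨h1, (iterate_partialDeriv_congr ih.2 j _).trans h2⟩

theorem coeff_iterate_pderiv (a : MvPowerSeries (Fin n) ℂ) (j : Fin n) (k : ℕ)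
    (β : Fin n →₀ ℕ) : ((MvPowerSeries.pderiv ℂ j)^[k] a).coeff β =
      (β j + 1).ascFactorial k * a.coeff (β + Finsupp.single j k) := by
  induction k generalizing a with
  | zero => simp
  | succ k ih =>
    rw [Function.iterate_succ_apply, ih, MvPowerSeries.coeff_pderiv, add_assoc,
      ← Finsupp.single_add, Nat.ascFactorial_succ]
    simp
    ring

/-- Since `β` vanishes on `l`, the rising factorial produced by each variable is exactly `(α j)!`.
Absence of repetitions keeps the shift by one variable from disturbing the others. -/
theorem coeff_foldr_pderiv (a : MvPowerSeries (Fin n) ℂ) (α : Fin n → ℕ) (l : List (Fin n))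
    (hl : l.Nodup) (β : Fin n →₀ ℕ) (hβ : ∀ j ∈ l, β j = 0) :
    (l.foldr (fun j g => (MvPowerSeries.pderiv ℂ j)^[α j] g) a).coeff β =
      (l.map fun j => ((α j).factorial : ℂ)).prod *
        a.coeff (β + (l.map fun j => Finsupp.single j (α j)).sum) := by
  induction l generalizing β with
  | nil => simp
  | cons j l ih =>
    rw [List.nodup_cons] at hl
    rw [List.foldr_cons, coeff_iterate_pderiv, ih hl.2]
    · rw [hβ j (by simp), zero_add, Nat.one_ascFactorial]
      simp [mul_assoc, add_assoc]
    · intro i hi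
      have hij : j ≠ i := by
        rintro rfl
        exact hl.1 hi
      simp [hβ i (by simp [hi]), hij]

theorem Conv.taylorCoeff_sumSeries {a : MvPowerSeries (Fin n) ℂ} (h : Conv a) (α : Fin n →₀ ℕ) :
    taylorCoeff α (sumSeries a) 0 = a.coeff α := by
  rw [taylorCoeff, multiDeriv, (h.foldr_partialDeriv α _).2.eq_of_nhds, sumSeries_zero_right,
    coeff_foldr_pderiv _ _ _ (List.nodup_finRange n) _ (by simp), zero_add]
  have h1 : ((List.finRange n).map fun j => ((α j).factorial : ℂ)).prod =
      ((∏ j, (α j).factorial : ℕ) : ℂ) := by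
    rw [← List.ofFn_eq_map, List.prod_ofFn, Nat.cast_prod]
  have h2 : ((List.finRange n).map fun j => Finsupp.single j (α j)).sum = α := by
    rw [← List.ofFn_eq_map, List.sum_ofFn]
    exact Finsupp.univ_sum_single α
  rw [h1, h2, mul_div_cancel_left₀]
  exact_mod_cast (Finset.prod_pos fun j _ => Nat.factorial_pos _).ne'

/-! ### Taylor expansion of analytic functions -/

/-- The Taylor series at the origin. -/
def taylorSeries (f : Cn n → ℂ) : MvPowerSeries (Fin n) ℂ :=
  fun α => taylorCoeff α f 0

theorem coeff_taylorSeries (f : Cn n → ℂ) (α : Fin n →₀ ℕ) :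
    (taylorSeries f).coeff α = taylorCoeff α f 0 := rfl

theorem Conv.taylorSeries_sumSeries {a : MvPowerSeries (Fin n) ℂ} (h : Conv a) :
    taylorSeries (sumSeries a) = a :=
  MvPowerSeries.ext fun α => h.taylorCoeff_sumSeries α

/-- Each homogeneous term is expanded multilinearly in the standard basis, which indexes the terms
by words in the coordinates; words containing each coordinate equally often give the same monomial
and are summed. -/
theorem exists_conv_of_analyticAt {f : Cn n → ℂ} (hf : AnalyticAt ℂ f 0) :
    ∃ a, Conv a ∧ f =ᶠ[𝓝 0] sumSeries a := by
  obtain ⟨p, r, hp⟩ := hf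
  let cnt : (Σ k, Fin k → Fin n) → (Fin n →₀ ℕ) := fun x => ∑ l, Finsupp.single (x.2 l) 1
  have hcnt : ∀ x, (cnt x).degree = x.1 := by
    intro x
    simp [cnt, map_sum]
  have hmon : ∀ x (z : Cn n), mon (cnt x) z = ∏ l, z (x.2 l) := by
    rintro ⟨k, i⟩ z
    have : ∀ s : Finset (Fin k), mon (∑ l ∈ s, Finsupp.single (i l) 1) z = ∏ l ∈ s, z (i l) := by
      intro s
      induction s using Finset.cons_induction with
      | empty => simp [mon_zero_left]
      | cons l s hl ih => rw [Finset.sum_cons, Finset.prod_cons, mon_add, mon_single, ih, pow_one]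
    exact this _
  let t : (Σ k, Fin k → Fin n) → ℂ := fun x => p x.1 fun l => Pi.single (x.2 l) 1
  have ht : ∀ x, ‖t x‖ ≤ ‖p x.1‖ := by
    intro x
    refine ((p x.1).le_opNorm _).trans (mul_le_of_le_one_right (norm_nonneg _) ?_)
    refine Finset.prod_le_one (fun _ _ => norm_nonneg _) fun l _ => ?_
    refine (pi_norm_le_iff_of_nonneg zero_le_one).2 fun i => ?_
    by_cases h : i = x.2 l
    · subst h
      simp
    · simp [h]
  obtain ⟨s, hs0, hsr⟩ := ENNReal.lt_iff_exists_nnreal_btwn.1 (hp.r_pos.trans_le hp.r_le)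
  have hs0' : (0 : ℝ) < s := by exact_mod_cast hs0
  obtain ⟨s', hs0', hsr'⟩ := ENNReal.lt_iff_exists_nnreal_btwn.1 hp.r_pos
  have hs1' : (0 : ℝ) < s' := by exact_mod_cast hs0'
  -- There are `n ^ k` words of length `k`, so absolute convergence needs `n * ρ ≤ s`; dividing by
  -- `n + 1` also covers `n = 0`. The bound by `s'` keeps `z` in the ball where `p` represents `f`.
  let ρ : ℝ := min (s / (n + 1)) s'
  have hρ : 0 < ρ := lt_min (by positivity) hs1'
  have hnρ : n * ρ ≤ s := by
    have : ρ ≤ s / (n + 1) := min_le_left _ _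
    rw [le_div_iff₀ (by positivity)] at this
    linarith
  have hsum : Summable fun x => ‖t x‖ * ρ ^ x.1 := by
    rw [summable_sigma_of_nonneg fun _ => by positivity]
    refine ⟨fun k => (hasSum_fintype _).summable, ?_⟩
    refine Summable.of_nonneg_of_le (fun k => tsum_nonneg fun _ => by positivity) (fun k => ?_)
      (p.summable_norm_mul_pow hsr)
    rw [tsum_fintype]
    calc _ ≤ ∑ _i : Fin k → Fin n, ‖p k‖ * ρ ^ k := by
          gcongr with i
          exact ht ⟨k, i⟩
      _ = ‖p k‖ * (n * ρ) ^ k := by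
          simp [mul_pow]
          ring
      _ ≤ _ := by gcongr
  refine ⟨fun α => ∑' x : ↑(cnt ⁻¹' {α}), t x, ⟨ρ, hρ, ?_⟩, ?_⟩
  · refine Summable.of_nonneg_of_le (fun _ => by positivity) (fun α => ?_)
      (hsum.hasSum.tsum_fiberwise cnt).summable
    have h1 : Summable fun x : ↑(cnt ⁻¹' {α}) => ‖t x‖ * ρ ^ x.1.1 := hsum.subtype _
    have h2 : ∀ x : ↑(cnt ⁻¹' {α}), x.1.1 = α.degree := fun x => by
      rw [← hcnt, show cnt x = α from x.2]
    simp only [h2] at h1 ⊢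
    rw [tsum_mul_right]
    have h3 : Summable fun x : ↑(cnt ⁻¹' {α}) => ‖t x‖ :=
      (summable_mul_right_iff (by positivity)).1 h1
    gcongr
    exact norm_tsum_le_tsum_norm h3
  · filter_upwards [Metric.ball_mem_nhds (0 : Cn n) hρ] with z hz
    have hz' : ‖z‖ < ρ := by simpa using hz
    have hzr : z ∈ Metric.eball (0 : Cn n) r := by
      rw [Metric.mem_eball, edist_zero_right]
      refine lt_trans ?_ hsr'
      rw [enorm_eq_nnnorm]
      exact_mod_cast (hz'.trans_le (min_le_right _ _) : ‖z‖ < s')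
    have hS : Summable fun x => t x * mon (cnt x) z := by
      refine Summable.of_norm (Summable.of_nonneg_of_le (fun _ => norm_nonneg _) (fun x => ?_) hsum)
      rw [norm_mul, ← hcnt x]
      gcongr
      exact norm_mon_le hz'.le _
    have h1 : HasSum (fun k : ℕ => p k fun _ => z) (∑' x, t x * mon (cnt x) z) := by
      refine hS.hasSum.sigma fun k => ?_
      have hz2 : z = ∑ i, z i • (Pi.single i 1 : Cn n) := by
        funext j
        simp [Pi.single_apply]
      have : (p k fun _ => z) = ∑ i : Fin k → Fin n, t ⟨k, i⟩ * mon (cnt ⟨k, i⟩) z := by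
        conv_lhs => rw [hz2]
        rw [(p k).map_sum]
        refine Finset.sum_congr rfl fun i _ => ?_
        rw [(p k).map_smul_univ, hmon, smul_eq_mul, mul_comm]
      rw [this]
      exact hasSum_fintype _
    have h2 := hp.hasSum hzr
    rw [zero_add] at h2
    rw [h2.unique h1]
    have h3 := hS.hasSum.tsum_fiberwise cnt
    rw [← h3.tsum_eq]
    refine tsum_congr fun α => ?_
    have : ∀ x : ↑(cnt ⁻¹' {α}), t x * mon (cnt x) z = t x * mon α z := fun x => by
      rw [show cnt x = α from x.2]
    simp only [this, tsum_mul_right]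
    rfl

theorem conv_taylorSeries_and_eventuallyEq {f : Cn n → ℂ} (hf : AnalyticAt ℂ f 0) :
    Conv (taylorSeries f) ∧ f =ᶠ[𝓝 0] sumSeries (taylorSeries f) := by
  obtain ⟨a, ha, hfa⟩ := exists_conv_of_analyticAt hf
  have : taylorSeries f = a := by
    rw [← ha.taylorSeries_sumSeries]
    exact MvPowerSeries.ext fun α => taylorCoeff_congr hfa α
  rw [this]
  exact ⟨ha, hfa⟩

theorem conv_taylorSeries {f : Cn n → ℂ} (hf : AnalyticAt ℂ f 0) : Conv (taylorSeries f) :=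
  (conv_taylorSeries_and_eventuallyEq hf).1

theorem eventuallyEq_sumSeries_taylorSeries {f : Cn n → ℂ} (hf : AnalyticAt ℂ f 0) :
    f =ᶠ[𝓝 0] sumSeries (taylorSeries f) :=
  (conv_taylorSeries_and_eventuallyEq hf).2

theorem taylorSeries_add {f g : Cn n → ℂ} (hf : AnalyticAt ℂ f 0) (hg : AnalyticAt ℂ g 0) :
    taylorSeries (f + g) = taylorSeries f + taylorSeries g := by
  have hF := conv_taylorSeries hf
  have hG := conv_taylorSeries hg
  rw [← (hF.add hG).taylorSeries_sumSeries]
  refine MvPowerSeries.ext fun α => taylorCoeff_congr ?_ α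
  exact ((eventuallyEq_sumSeries_taylorSeries hf).add
    (eventuallyEq_sumSeries_taylorSeries hg)).trans (hF.sumSeries_add hG).symm

theorem taylorSeries_smul {f : Cn n → ℂ} (hf : AnalyticAt ℂ f 0) (c : ℂ) :
    taylorSeries (c • f) = c • taylorSeries f := by
  have hF := conv_taylorSeries hf
  rw [← (hF.smul c).taylorSeries_sumSeries, sumSeries_smul]
  refine MvPowerSeries.ext fun α => taylorCoeff_congr ?_ α
  exact (eventuallyEq_sumSeries_taylorSeries hf).const_smul c

theorem taylorSeries_sub {f g : Cn n → ℂ} (hf : AnalyticAt ℂ f 0) (hg : AnalyticAt ℂ g 0) :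
    taylorSeries (f - g) = taylorSeries f - taylorSeries g := by
  have h : f - g = f + (-1 : ℂ) • g := by
    funext z
    simp [sub_eq_add_neg]
  have hg' : AnalyticAt ℂ ((-1 : ℂ) • g) 0 := hg.const_smul
  rw [h, taylorSeries_add hf hg', taylorSeries_smul hg]
  simp [sub_eq_add_neg]

/-! ### Cauchy estimates on polydiscs -/

theorem analyticOnNhd_partialDeriv {f : Cn n → ℂ} {U : Set (Cn n)} (hf : AnalyticOnNhd ℂ f U)
    (j : Fin n) : AnalyticOnNhd ℂ (partialDeriv j f) U := fun z hz =>
  ((ContinuousLinearMap.apply ℂ ℂ (Pi.single j 1 : Cn n)).analyticAt _).comp (hf.fderiv z hz)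

theorem analyticOnNhd_iterate_partialDeriv {f : Cn n → ℂ} {U : Set (Cn n)}
    (hf : AnalyticOnNhd ℂ f U) (j : Fin n) (k : ℕ) :
    AnalyticOnNhd ℂ ((partialDeriv j)^[k] f) U := by
  induction k generalizing f with
  | zero => exact hf
  | succ k ih => exact ih (analyticOnNhd_partialDeriv hf j)

theorem analyticOnNhd_foldr_partialDeriv {f : Cn n → ℂ} {U : Set (Cn n)}
    (hf : AnalyticOnNhd ℂ f U) (α : Fin n → ℕ) (l : List (Fin n)) :
    AnalyticOnNhd ℂ (l.foldr (fun j g => (partialDeriv j)^[α j] g) f) U := by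
  induction l with
  | nil => exact hf
  | cons j l ih => exact analyticOnNhd_iterate_partialDeriv ih j _

theorem hasDerivAt_comp_update {f : Cn n → ℂ} (z : Cn n) (j : Fin n) (w : ℂ)
    (hf : DifferentiableAt ℂ f (Function.update z j w)) :
    HasDerivAt (fun w => f (Function.update z j w)) (partialDeriv j f (Function.update z j w)) w :=
  hf.hasFDerivAt.comp_hasDerivAt w (hasDerivAt_update z j w)

theorem continuous_update_right (z : Cn n) (j : Fin n) :
    Continuous fun w : ℂ => Function.update z j w :=
  continuous_const.update j continuous_id

theorem iterate_partialDeriv_eq_iteratedDeriv {f : Cn n → ℂ} {U : Set (Cn n)} (hU : IsOpen U)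
    (hf : AnalyticOnNhd ℂ f U) {z : Cn n} (hz : z ∈ U) (j : Fin n) (k : ℕ) :
    (partialDeriv j)^[k] f z = iteratedDeriv k (fun w => f (Function.update z j w)) (z j) := by
  induction k generalizing f with
  | zero => simp
  | succ k ih =>
    rw [Function.iterate_succ_apply, ih (analyticOnNhd_partialDeriv hf j), iteratedDeriv_succ']
    refine EventuallyEq.iteratedDeriv_eq k ?_
    have h : ∀ᶠ w in 𝓝 (z j), Function.update z j w ∈ U :=
      (continuous_update_right z j).continuousAt.eventually
        (by simpa using hU.mem_nhds hz)
    filter_upwards [h] with w hw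
    exact (hasDerivAt_comp_update z j w (hf _ hw).differentiableAt).deriv.symm

/-- One-variable Cauchy estimates on circles of radius `r`, one coordinate at a time. Coordinates
already differentiated must stay within `R - r`, the others may range up to `R`. -/
theorem norm_foldr_partialDeriv_le {f : Cn n → ℂ} {R r M : ℝ} (hr : 0 < r) (hrR : r < R)
    (hf : AnalyticOnNhd ℂ f (Metric.ball 0 R)) (hM : ∀ z ∈ Metric.ball (0 : Cn n) R, ‖f z‖ ≤ M)
    (α : Fin n → ℕ) (l : List (Fin n)) (hl : l.Nodup) (z : Cn n)
    (hz : ∀ i, ‖z i‖ < if i ∈ l then R - r else R) :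
    ‖l.foldr (fun j g => (partialDeriv j)^[α j] g) f z‖ ≤
      M * (l.map fun j => ((α j).factorial : ℝ) / r ^ α j).prod := by
  have hR : 0 < R := hr.trans hrR
  have hball : ∀ z : Cn n, z ∈ Metric.ball 0 R ↔ ∀ i, ‖z i‖ < R := fun z => by
    rw [mem_ball_zero_iff, pi_norm_lt_iff hR]
  induction l generalizing z with
  | nil => simpa using hM z ((hball z).2 (by simpa using hz))
  | cons j l ih =>
    rw [List.nodup_cons] at hl
    have hzR : ∀ i, ‖z i‖ < R := fun i => (hz i).trans_le (by split_ifs <;> linarith)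
    have hg := analyticOnNhd_foldr_partialDeriv hf α l
    set g := l.foldr (fun j g => (partialDeriv j)^[α j] g) f with hgdef
    rw [List.foldr_cons,
      iterate_partialDeriv_eq_iteratedDeriv Metric.isOpen_ball hg ((hball z).2 hzR)]
    have hzj : ‖z j‖ < R - r := by simpa using hz j
    have hupd : ∀ w ∈ Metric.closedBall (z j) r, ∀ i,
        ‖Function.update z j w i‖ < if i ∈ l then R - r else R := by
      intro w hw i
      have hwn : ‖w‖ < R := by
        have h1 : ‖w - z j‖ ≤ r := by simpa [dist_eq_norm] using hw
        have h2 := norm_add_le (w - z j) (z j)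
        rw [sub_add_cancel] at h2
        linarith
      by_cases hij : i = j
      · subst hij
        simpa [hl.1] using hwn
      · have := hz i
        simpa [hij] using this
    have hupd' : ∀ w ∈ Metric.closedBall (z j) r, Function.update z j w ∈ Metric.ball 0 R := by
      intro w hw
      refine (hball _).2 fun i => (hupd w hw i).trans_le ?_
      split_ifs <;> linarith
    have hd : DiffContOnCl ℂ (fun w => g (Function.update z j w)) (Metric.ball (z j) r) := by
      refine DifferentiableOn.diffContOnCl fun w hw => ?_
      rw [closure_ball _ hr.ne'] at hw
      exact (hasDerivAt_comp_update z j w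
        (hg _ (hupd' w hw)).differentiableAt).differentiableAt.differentiableWithinAt
    refine (Complex.norm_iteratedDeriv_le_of_forall_mem_sphere_norm_le (α j) hr hd
      fun w hw => ih hl.2 _ (hupd w (Metric.sphere_subset_closedBall hw))).trans_eq ?_
    rw [List.map_cons, List.prod_cons]
    ring

theorem norm_taylorCoeff_le {f : Cn n → ℂ} {R r M : ℝ} (hr : 0 < r) (hrR : r < R)
    (hf : AnalyticOnNhd ℂ f (Metric.ball 0 R)) (hM : ∀ z ∈ Metric.ball (0 : Cn n) R, ‖f z‖ ≤ M)
    (α : Fin n →₀ ℕ) : ‖taylorCoeff α f 0‖ ≤ M / r ^ α.degree := by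
  have h := norm_foldr_partialDeriv_le hr hrR hf hM α (List.finRange n) (List.nodup_finRange n) 0
    (by simp [hrR])
  rw [← List.ofFn_eq_map, List.prod_ofFn, Finset.prod_div_distrib, Finset.prod_pow_eq_pow_sum,
    ← Finsupp.degree_eq_sum] at h
  have hpos : (0 : ℝ) < ∏ j, ((α j).factorial : ℝ) :=
    Finset.prod_pos fun j _ => by exact_mod_cast Nat.factorial_pos _
  rw [taylorCoeff, norm_div, Complex.norm_natCast, multiDeriv, Nat.cast_prod, div_le_iff₀ hpos]
  refine h.trans_eq ?_
  ring

/-- A product of `n` geometric series. -/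
theorem summable_pow_degree {q : ℝ} (hq0 : 0 ≤ q) (hq1 : q < 1) :
    Summable fun α : Fin n →₀ ℕ => q ^ α.degree := by
  have key : ∀ m : ℕ, Summable fun α : Fin m → ℕ => q ^ ∑ j, α j := by
    intro m
    induction m with
    | zero => exact (hasSum_fintype _).summable
    | succ m ih =>
      rw [← (Fin.consEquiv fun _ : Fin (m + 1) => ℕ).summable_iff]
      have := (summable_geometric_of_lt_one hq0 hq1).mul_of_nonneg ih
        (fun _ => by positivity) (fun _ => by positivity)
      refine this.congr fun x => ?_
      simp [Fin.sum_univ_succ, pow_add]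
  have := (Finsupp.equivFunOnFinite : (Fin n →₀ ℕ) ≃ (Fin n → ℕ)).summable_iff.2 (key n)
  refine this.congr fun α => ?_
  simp [Finsupp.degree_eq_sum]

theorem convAt_of_norm_coeff_le {a : MvPowerSeries (Fin n) ℂ} {ρ r M : ℝ} (hρ : 0 ≤ ρ)
    (hρr : ρ < r) (h : ∀ α, ‖a.coeff α‖ ≤ M / r ^ α.degree) : ConvAt ρ a := by
  have hr : 0 < r := hρ.trans_lt hρr
  have := (summable_pow_degree (n := n) (q := ρ / r) (by positivity)
    ((div_lt_one hr).2 hρr)).mul_left M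
  refine Summable.of_nonneg_of_le (fun _ => by positivity) (fun α => ?_) this
  calc _ ≤ M / r ^ α.degree * ρ ^ α.degree := by gcongr; exact h α
    _ = _ := by rw [div_pow]; ring

theorem convAt_taylorSeries {f : Cn n → ℂ} {ρ R M : ℝ} (hρ : 0 ≤ ρ) (hρR : ρ < R)
    (hf : AnalyticOnNhd ℂ f (Metric.ball 0 R)) (hM : ∀ z ∈ Metric.ball (0 : Cn n) R, ‖f z‖ ≤ M) :
    ConvAt ρ (taylorSeries f) := by
  obtain ⟨r, hρr, hrR⟩ := exists_between hρR
  exact convAt_of_norm_coeff_le hρ hρr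
    fun α => norm_taylorCoeff_le (hρ.trans_lt hρr) hrR hf hM α

/-- The Cauchy estimates make the Taylor series converge on smaller balls, and the identity theorem
propagates the local equality. -/
theorem eq_sumSeries_taylorSeries {f : Cn n → ℂ} {R M : ℝ}
    (hf : AnalyticOnNhd ℂ f (Metric.ball 0 R)) (hM : ∀ z ∈ Metric.ball (0 : Cn n) R, ‖f z‖ ≤ M)
    {z : Cn n} (hz : ‖z‖ < R) : f z = sumSeries (taylorSeries f) z := by
  obtain ⟨ρ, hzρ, hρR⟩ := exists_between hz
  have hρ : 0 < ρ := (norm_nonneg z).trans_lt hzρ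
  have h1 := (convAt_taylorSeries hρ.le hρR hf hM).analyticOnNhd
  have h2 := hf.mono (Metric.ball_subset_ball hρR.le)
  have h0 : (0 : Cn n) ∈ Metric.ball 0 ρ := Metric.mem_ball_self hρ
  refine h2.eqOn_of_preconnected_of_eventuallyEq h1 (convex_ball _ _).isPreconnected h0
    (eventuallyEq_sumSeries_taylorSeries (h2 0 h0)) ?_
  simpa using hzρ

/-! ### The mean value inequality and local bounds in the Bergman space -/

theorem measurePreserving_rotation (θ : ℝ) :
    MeasurePreserving (fun w : Cn n => Complex.exp (θ * Complex.I) • w) := by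
  have h : MeasurePreserving (fun w : ℂ => Complex.exp (θ * Complex.I) * w) := by
    have := (rotation (Circle.exp θ)).measurePreserving
    convert! this using 2
  exact volume_preserving_pi fun _ : Fin n => h

/-- The mean value property on each circle `z₀ + e^{iθ} w` is integrated over `w`. After exchanging
the integrals, rotation invariance of Lebesgue measure makes the inner one independent of `θ`. -/
theorem enorm_mul_volume_ball_le {g : Cn n → ℂ} {z₀ : Cn n} {r : ℝ}
    (hg : AnalyticOnNhd ℂ g (Metric.ball z₀ r)) :
    ‖g z₀‖ₑ * volume (Metric.ball (0 : Cn n) r) ≤ ∫⁻ z in Metric.ball z₀ r, ‖g z‖ₑ := by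
  classical
  let G : Cn n → ℝ≥0∞ := (Metric.ball z₀ r).indicator fun z => ‖g z‖ₑ
  have hG : Measurable G := by
    have : ContinuousOn (fun z => ‖g z‖ₑ) (Metric.ball z₀ r) :=
      hg.continuousOn.enorm
    have h := this.measurable_piecewise (g := 0) continuousOn_const
      Metric.isOpen_ball.measurableSet
    rwa [Set.piecewise_eq_indicator] at h
  let c : ℝ → ℂ := fun θ => Complex.exp (θ * Complex.I)
  have hc : Continuous c := by fun_prop
  have hcn : ∀ θ, ‖c θ‖ = 1 := fun θ => Complex.norm_exp_ofReal_mul_I θ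
  have hinv : ∀ θ, ∫⁻ w, G (z₀ + c θ • w) = ∫⁻ z in Metric.ball z₀ r, ‖g z‖ₑ := by
    intro θ
    rw [(measurePreserving_rotation θ).lintegral_comp (f := fun w => G (z₀ + w))
      (hG.comp (measurable_const_add z₀)), lintegral_add_left_eq_self G z₀,
      lintegral_indicator Metric.isOpen_ball.measurableSet]
  let I : Set ℝ := Set.Ioc 0 (2 * Real.pi)
  have hvol : volume I = ENNReal.ofReal (2 * Real.pi) := by simp [I]
  have hv0 : volume I ≠ 0 := by
    rw [hvol]
    simpa using Real.pi_pos
  have hvt : volume I ≠ ∞ := by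
    rw [hvol]
    exact ENNReal.ofReal_ne_top
  have hmean : ∀ w ∈ Metric.ball (0 : Cn n) r,
      volume I * ‖g z₀‖ₑ ≤ ∫⁻ θ in I, G (z₀ + c θ • w) := by
    intro w hw
    have hw' : ‖w‖ < r := by simpa using hw
    have hmem : ∀ ζ : ℂ, ‖ζ‖ ≤ 1 → z₀ + ζ • w ∈ Metric.ball z₀ r := by
      intro ζ hζ
      rw [mem_ball_iff_norm, add_sub_cancel_left, norm_smul]
      exact (mul_le_of_le_one_left (norm_nonneg w) hζ).trans_lt hw'
    have hd : DiffContOnCl ℂ (fun ζ : ℂ => g (z₀ + ζ • w)) (Metric.ball 0 |1|) := by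
      refine DifferentiableOn.diffContOnCl fun ζ hζ => ?_
      rw [abs_one, closure_ball _ one_ne_zero] at hζ
      have h1 : DifferentiableAt ℂ g (z₀ + ζ • w) :=
        (hg _ (hmem ζ (by simpa using hζ))).differentiableAt
      exact (h1.comp ζ (by fun_prop)).differentiableWithinAt
    have h := hd.circleAverage
    have h2 : ∀ θ, circleMap 0 1 θ = c θ := fun θ => by simp [circleMap, c]
    rw [Real.circleAverage_def, zero_smul, add_zero] at h
    simp only [h2] at h
    have h3 : (2 * Real.pi : ℝ) • g z₀ = ∫ θ in I, g (z₀ + c θ • w) := by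
      rw [← h, smul_smul, mul_inv_cancel₀ (by positivity), one_smul,
        intervalIntegral.integral_of_le (by positivity)]
    calc volume I * ‖g z₀‖ₑ = ‖(2 * Real.pi : ℝ) • g z₀‖ₑ := by
          rw [enorm_smul, hvol, Real.enorm_of_nonneg (by positivity)]
      _ ≤ ∫⁻ θ in I, ‖g (z₀ + c θ • w)‖ₑ := by
          rw [h3]
          exact enorm_integral_le_lintegral_enorm _
      _ = _ := by
          refine lintegral_congr fun θ => ?_
          exact (Set.indicator_of_mem (hmem _ (hcn θ).le) fun z => ‖g z‖ₑ).symm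
  have hjoint : Measurable fun p : Cn n × ℝ => G (z₀ + c p.2 • p.1) := by
    refine hG.comp (Continuous.measurable ?_)
    fun_prop
  have hfinal : volume I * (‖g z₀‖ₑ * volume (Metric.ball (0 : Cn n) r)) ≤
      volume I * ∫⁻ z in Metric.ball z₀ r, ‖g z‖ₑ := by
    calc _ = ∫⁻ _w in Metric.ball (0 : Cn n) r, volume I * ‖g z₀‖ₑ := by
          rw [setLIntegral_const, mul_assoc]
      _ ≤ ∫⁻ w in Metric.ball (0 : Cn n) r, ∫⁻ θ in I, G (z₀ + c θ • w) :=
          setLIntegral_mono' Metric.isOpen_ball.measurableSet hmean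
      _ ≤ ∫⁻ w, ∫⁻ θ in I, G (z₀ + c θ • w) := setLIntegral_le_lintegral _ _
      _ = ∫⁻ θ in I, ∫⁻ w, G (z₀ + c θ • w) :=
          lintegral_lintegral_swap hjoint.aemeasurable
      _ = _ := by
          simp only [hinv]
          rw [setLIntegral_const, mul_comm]
  exact (ENNReal.mul_le_mul_iff_right hv0 hvt).1 hfinal

/-- The mean value inequality is applied to `f²`, on balls of radius `r` that remain inside the ball
of radius `2r`. -/
theorem exists_bound_of_normSqOn_le {D : Set (Cn n)} {z₀ : Cn n} {r : ℝ} (hr : 0 < r)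
    (hD : Metric.ball z₀ (2 * r) ⊆ D) {B : ℝ≥0∞} (hB : B ≠ ∞) :
    ∃ M : ℝ, ∀ f : Cn n → ℂ, AnalyticOnNhd ℂ f D → normSqOn D f ≤ B →
      ∀ z ∈ Metric.ball z₀ r, ‖f z‖ ≤ M := by
  have hv0 : volume (Metric.ball (0 : Cn n) r) ≠ 0 :=
    (Metric.measure_ball_pos volume _ hr).ne'
  have hvt : volume (Metric.ball (0 : Cn n) r) ≠ ∞ := measure_ball_lt_top.ne
  refine ⟨√(B / volume (Metric.ball (0 : Cn n) r)).toReal, fun f hf hfB z hz => ?_⟩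
  have hsub : Metric.ball z r ⊆ D := by
    refine (Metric.ball_subset_ball' ?_).trans hD
    have := (Metric.mem_ball.1 hz).le
    linarith
  have h1 := enorm_mul_volume_ball_le (g := fun z => f z ^ 2) (z₀ := z) (r := r)
    fun w hw => (hf w (hsub hw)).pow 2
  simp only [enorm_pow] at h1
  have h2 : ‖f z‖ₑ ^ 2 ≤ B / volume (Metric.ball (0 : Cn n) r) := by
    rw [ENNReal.le_div_iff_mul_le (Or.inl hv0) (Or.inl hvt)]
    exact h1.trans ((lintegral_mono_set hsub).trans hfB)
  have h3 := ENNReal.toReal_mono (ENNReal.div_lt_top hB hv0).ne h2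
  refine Real.le_sqrt_of_sq_le ?_
  simpa using h3

/-! ### Compactness of bounded sets of the Bergman space -/

theorem tendsto_sumSeries {a : ℕ → MvPowerSeries (Fin n) ℂ} {b : MvPowerSeries (Fin n) ℂ}
    {r M : ℝ} (ha : ∀ k α, ‖(a k).coeff α‖ ≤ M / r ^ α.degree)
    (hab : ∀ α, Tendsto (fun k => (a k).coeff α) atTop (𝓝 (b.coeff α))) {z : Cn n} (hz : ‖z‖ < r) :
    Tendsto (fun k => sumSeries (a k) z) atTop (𝓝 (sumSeries b z)) := by
  have hr : 0 < r := (norm_nonneg z).trans_lt hz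
  refine tendsto_tsum_of_dominated_convergence
    ((summable_pow_degree (n := n) (q := ‖z‖ / r) (by positivity)
      ((div_lt_one hr).2 hz)).mul_left M) (fun α => (hab α).mul_const _)
    (Eventually.of_forall fun k α => ?_)
  rw [norm_mul]
  calc _ ≤ M / r ^ α.degree * ‖z‖ ^ α.degree :=
        mul_le_mul (ha k α) (norm_mon_le le_rfl α) (norm_nonneg _) ((norm_nonneg _).trans (ha k α))
    _ = _ := by rw [div_pow]; ring

theorem analyticOnNhd_comp_const_add {f : Cn n → ℂ} {z₀ : Cn n} {r : ℝ}
    (hf : AnalyticOnNhd ℂ f (Metric.ball z₀ r)) :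
    AnalyticOnNhd ℂ (fun w => f (z₀ + w)) (Metric.ball 0 r) := by
  intro w hw
  have h : z₀ + w ∈ Metric.ball z₀ r := by simpa using hw
  exact (hf _ h).comp (analyticAt_const.add analyticAt_id)

/-- Montel's theorem for bounded sequences in `A²(D)`. -/
theorem exists_subseq_tendsto_of_normSqOn_le {D : Set (Cn n)} (hD : IsOpen D)
    (h0 : (0 : Cn n) ∈ D) {B : ℝ≥0∞} (hB : B ≠ ∞) (f : ℕ → Cn n → ℂ)
    (hf : ∀ k, AnalyticOnNhd ℂ (f k) D) (hfB : ∀ k, normSqOn D (f k) ≤ B) :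
    ∃ (φ : ℕ → ℕ) (g : Cn n → ℂ), StrictMono φ ∧ AnalyticOnNhd ℂ g D ∧ normSqOn D g ≤ B ∧
      ∀ α : Fin n →₀ ℕ, Tendsto (fun k => taylorCoeff α (f (φ k)) 0) atTop
        (𝓝 (taylorCoeff α g 0)) := by
  have hr : ∀ z₀ : Cn n, ∃ r : ℝ, 0 < r ∧ (z₀ ∈ D → Metric.ball z₀ (2 * r) ⊆ D) := by
    intro z₀
    by_cases hz : z₀ ∈ D
    · obtain ⟨r, hr, h⟩ := Metric.isOpen_iff.1 hD z₀ hz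
      exact ⟨r / 2, by positivity, fun _ => by rwa [mul_div_cancel₀ _ two_ne_zero]⟩
    · exact ⟨1, one_pos, fun h => absurd h hz⟩
  choose r hr hrD using hr
  have hM : ∀ z₀ : Cn n, ∃ M : ℝ, z₀ ∈ D → ∀ k, ∀ z ∈ Metric.ball z₀ (r z₀), ‖f k z‖ ≤ M := by
    intro z₀
    by_cases hz : z₀ ∈ D
    · obtain ⟨M, hM⟩ := exists_bound_of_normSqOn_le (hr z₀) (hrD z₀ hz) hB
      exact ⟨M, fun _ k => hM (f k) (hf k) (hfB k)⟩
    · exact ⟨0, fun h => absurd h hz⟩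
  choose M hM using hM
  -- Lindelöf: countably many half-size balls cover `D`.
  obtain ⟨t, htD, htc, htcover⟩ := TopologicalSpace.countable_cover_nhdsWithin
    (f := fun z₀ : Cn n => Metric.ball z₀ (r z₀ / 2)) (s := D)
    fun z₀ _ => mem_nhdsWithin_of_mem_nhds (Metric.ball_mem_nhds _ (half_pos (hr z₀)))
  -- The origin is added as a centre because convergence of the coefficients there is part of the
  -- conclusion.
  let S : Set (Cn n) := insert 0 t
  have hSD : S ⊆ D := Set.insert_subset h0 htD
  have : Countable S := (htc.insert 0).to_subtype
  let a : S → ℕ → MvPowerSeries (Fin n) ℂ := fun z₀ k => taylorSeries fun w => f k (z₀ + w)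
  have han : ∀ (z₀ : S) k,
      AnalyticOnNhd ℂ (fun w => f k (z₀ + w)) (Metric.ball 0 (r z₀)) := fun z₀ k =>
    analyticOnNhd_comp_const_add ((hf k).mono
      ((Metric.ball_subset_ball (by linarith [hr z₀])).trans (hrD z₀ (hSD z₀.2))))
  have hbd : ∀ (z₀ : S) k, ∀ w ∈ Metric.ball (0 : Cn n) (r z₀), ‖f k (z₀ + w)‖ ≤ M z₀ :=
    fun z₀ k w hw => hM z₀ (hSD z₀.2) k _ (by simpa using hw)
  have ha : ∀ z₀ k α, ‖(a z₀ k).coeff α‖ ≤ M z₀ / (r z₀ / 2) ^ α.degree := fun z₀ k α =>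
    norm_taylorCoeff_le (half_pos (hr z₀)) (half_lt_self (hr z₀)) (han z₀ k) (hbd z₀ k) α
  -- All Taylor coefficients at all centres lie in a product of discs, compact by Tychonoff. The
  -- product is countable, so a single subsequence converges in every coordinate.
  have hcpt : IsCompact (Set.pi Set.univ fun x : S × (Fin n →₀ ℕ) =>
      Metric.closedBall (0 : ℂ) (M x.1 / (r x.1 / 2) ^ x.2.degree)) :=
    isCompact_univ_pi fun _ => isCompact_closedBall _ _
  obtain ⟨c, -, φ, hφ, hc⟩ := hcpt.tendsto_subseq
    (x := fun k (x : S × (Fin n →₀ ℕ)) => (a x.1 k).coeff x.2)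
    fun k x _ => by simpa using ha x.1 k x.2
  rw [tendsto_pi_nhds] at hc
  let b : S → MvPowerSeries (Fin n) ℂ := fun z₀ α => c (z₀, α)
  have hb : ∀ z₀ α, Tendsto (fun k => (a z₀ (φ k)).coeff α) atTop (𝓝 ((b z₀).coeff α)) :=
    fun z₀ α => hc (z₀, α)
  have hbn : ∀ z₀ α, ‖(b z₀).coeff α‖ ≤ M z₀ / (r z₀ / 2) ^ α.degree := fun z₀ α =>
    le_of_tendsto (hb z₀ α).norm (Eventually.of_forall fun k => ha z₀ (φ k) α)
  have hlim : ∀ (z₀ : S), ∀ z ∈ Metric.ball (z₀ : Cn n) (r z₀ / 2),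
      Tendsto (fun k => f (φ k) z) atTop (𝓝 (sumSeries (b z₀) (z - z₀))) := by
    intro z₀ z hz
    have hz' : ‖z - z₀‖ < r z₀ / 2 := mem_ball_iff_norm.1 hz
    refine (tendsto_sumSeries (fun k => ha z₀ (φ k)) (hb z₀) hz').congr fun k => ?_
    rw [← eq_sumSeries_taylorSeries (han z₀ (φ k)) (hbd z₀ (φ k))
      (hz'.trans (half_lt_self (hr z₀))), add_sub_cancel]
  -- A pointwise limit, so the local expansions at different centres agree on overlaps without
  -- further argument.
  let g : Cn n → ℂ := fun z => limUnder atTop fun k => f (φ k) z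
  have hg : ∀ (z₀ : S), ∀ z ∈ Metric.ball (z₀ : Cn n) (r z₀ / 2),
      g z = sumSeries (b z₀) (z - z₀) := fun z₀ z hz => (hlim z₀ z hz).limUnder_eq
  have hcover : ∀ z ∈ D, ∃ z₀ : S, z ∈ Metric.ball (z₀ : Cn n) (r z₀ / 2) := by
    intro z hz
    obtain ⟨z₀, hz₀, h⟩ := Set.mem_iUnion₂.1 (htcover hz)
    exact ⟨⟨z₀, Set.mem_insert_of_mem _ hz₀⟩, h⟩
  have hglim : ∀ z ∈ D, Tendsto (fun k => f (φ k) z) atTop (𝓝 (g z)) := by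
    intro z hz
    obtain ⟨z₀, h⟩ := hcover z hz
    rw [hg z₀ z h]
    exact hlim z₀ z h
  refine ⟨φ, g, hφ, fun z hz => ?_, ?_, fun α => ?_⟩
  · obtain ⟨z₀, h⟩ := hcover z hz
    obtain ⟨ρ, hzρ, hρ⟩ := exists_between (mem_ball_iff_norm.1 h)
    have h1 : AnalyticAt ℂ (sumSeries (b z₀)) (z - z₀) :=
      (convAt_of_norm_coeff_le ((norm_nonneg _).trans_lt hzρ).le hρ
        (hbn z₀)).analyticOnNhd _ (by simpa using hzρ)
    have h2 : AnalyticAt ℂ (fun z => sumSeries (b z₀) (z - z₀)) z :=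
      h1.comp (f := fun z : Cn n => z - (z₀ : Cn n)) (analyticAt_id.sub analyticAt_const)
    refine h2.congr ?_
    filter_upwards [Metric.isOpen_ball.mem_nhds h] with w hw
    exact (hg z₀ w hw).symm
  · have hm : ∀ k, AEMeasurable (fun z => ‖f (φ k) z‖ₑ ^ 2) (volume.restrict D) := fun k =>
      ((hf _).continuousOn.aemeasurable hD.measurableSet).enorm.pow_const 2
    -- Fatou's lemma.
    calc normSqOn D g = ∫⁻ z in D, liminf (fun k => ‖f (φ k) z‖ₑ ^ 2) atTop := by
          refine setLIntegral_congr_fun hD.measurableSet fun z hz => ?_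
          exact (((ENNReal.continuous_pow 2).tendsto _).comp (hglim z hz).enorm).liminf_eq.symm
      _ ≤ liminf (fun k => ∫⁻ z in D, ‖f (φ k) z‖ₑ ^ 2) atTop := lintegral_liminf_le' hm
      _ ≤ liminf (fun _ : ℕ => B) atTop := liminf_le_liminf (Eventually.of_forall fun k => hfB _)
      _ = B := liminf_const B
  · let o : S := ⟨0, Set.mem_insert _ _⟩
    have h1 : taylorCoeff α g 0 = (b o).coeff α := by
      have hconv : Conv (b o) := ⟨r 0 / 4, by linarith [hr 0],
        convAt_of_norm_coeff_le (by linarith [hr 0]) (by linarith [hr 0]) (hbn o)⟩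
      rw [← hconv.taylorCoeff_sumSeries]
      refine taylorCoeff_congr ?_ α
      filter_upwards [Metric.ball_mem_nhds (0 : Cn n) (half_pos (hr 0))] with z hz
      rw [hg o z hz]
      simp [o]
    rw [h1]
    simpa [a, o, coeff_taylorSeries] using hb o α

/-! ### Division in the ring of convergent power series -/

/-- The natural number `p₁^{α₁} ⋯ pₙ^{αₙ}`, where `p_j` is the `j`-th prime. It is multiplicative
and injective in `α` and serves to order the exponents. -/
def primeCode (α : Fin n →₀ ℕ) : ℕ := ∏ j : Fin n, Nat.nth Nat.Prime j ^ α j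

theorem primeCode_add (α β : Fin n →₀ ℕ) :
    primeCode (α + β) = primeCode α * primeCode β := by
  simp [primeCode, pow_add, Finset.prod_mul_distrib]

/-- Together with `primeCode_le` this traps the code between two exponentials of the degree, so the
weights `p^{-sα}` can be compared with polyradii. -/
theorem two_pow_degree_le_primeCode (α : Fin n →₀ ℕ) : 2 ^ α.degree ≤ primeCode α := by
  rw [Finsupp.degree_eq_sum, ← Finset.prod_pow_eq_pow_sum, primeCode]
  gcongr with j
  exact (Nat.prime_nth_prime j).two_le

theorem primeCode_pos (α : Fin n →₀ ℕ) : 0 < primeCode α :=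
  (by positivity : 0 < 2 ^ α.degree).trans_le (two_pow_degree_le_primeCode α)

theorem primeCode_le (α : Fin n →₀ ℕ) : primeCode α ≤ Nat.nth Nat.Prime n ^ α.degree := by
  rw [Finsupp.degree_eq_sum, ← Finset.prod_pow_eq_pow_sum, primeCode]
  gcongr with j
  exact (Nat.nth_strictMono Nat.infinite_setOfPred_prime).monotone j.2.le

/-- Unique factorisation: the exponents are read off from the prime factorisation of the code. -/
theorem primeCode_injective : Function.Injective (primeCode : (Fin n →₀ ℕ) → ℕ) := by
  let e : Fin n ↪ ℕ := ⟨fun j => Nat.nth Nat.Prime j,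
    (Nat.nth_injective Nat.infinite_setOfPred_prime).comp Fin.val_injective⟩
  have h : ∀ α : Fin n →₀ ℕ, (primeCode α).factorization = α.embDomain e := by
    intro α
    rw [← Nat.prod_pow_factorization_eq_self (f := α.embDomain e), Finsupp.prod_embDomain,
      Finsupp.prod_fintype]
    · rfl
    · simp
    · intro p hp
      rw [Finsupp.support_embDomain, Finset.mem_map] at hp
      obtain ⟨j, -, rfl⟩ := hp
      exact Nat.prime_nth_prime j
  intro α β hαβ
  refine Finsupp.embDomain_injective e ?_
  rw [← h, ← h, hαβ]

theorem finite_primeCode_le (k : ℕ) : {α : Fin n →₀ ℕ | primeCode α ≤ k}.Finite :=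
  (Set.finite_Iic k).preimage primeCode_injective.injOn

/-! ### Weighted `ℓ¹` norms of power series -/

/-- The weight `p^{-sα}`. -/
def wt (s : ℕ) (α : Fin n →₀ ℕ) : ℝ≥0∞ := (primeCode α : ℝ≥0∞)⁻¹ ^ s

theorem wt_add (s : ℕ) (α β : Fin n →₀ ℕ) : wt s (α + β) = wt s α * wt s β := by
  rw [wt, wt, wt, primeCode_add, Nat.cast_mul, ENNReal.mul_inv (by simp) (by simp), mul_pow]

theorem primeCode_cast_ne_zero (α : Fin n →₀ ℕ) : (primeCode α : ℝ≥0∞) ≠ 0 := by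
  exact_mod_cast (primeCode_pos α).ne'

theorem wt_ne_zero (s : ℕ) (α : Fin n →₀ ℕ) : wt s α ≠ 0 := by
  simp [wt]

theorem wt_ne_top (s : ℕ) (α : Fin n →₀ ℕ) : wt s α ≠ ∞ :=
  ENNReal.pow_ne_top (ENNReal.inv_ne_top.2 (primeCode_cast_ne_zero α))

theorem wt_anti {s t : ℕ} (hst : s ≤ t) (α : Fin n →₀ ℕ) : wt t α ≤ wt s α := by
  refine pow_le_pow_right_of_le_one' (ENNReal.inv_le_one.2 ?_) hst
  exact_mod_cast primeCode_pos α

/-- The weighted `ℓ¹` norm of a power series. -/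
def wnorm (s : ℕ) (a : MvPowerSeries (Fin n) ℂ) : ℝ≥0∞ := ∑' α, ‖a.coeff α‖ₑ * wt s α

theorem wnorm_anti {s t : ℕ} (hst : s ≤ t) (a : MvPowerSeries (Fin n) ℂ) :
    wnorm t a ≤ wnorm s a :=
  ENNReal.tsum_le_tsum fun α => by gcongr; exact wt_anti hst α

theorem wnorm_add_le (s : ℕ) (a b : MvPowerSeries (Fin n) ℂ) :
    wnorm s (a + b) ≤ wnorm s a + wnorm s b := by
  rw [wnorm, wnorm, wnorm, ← ENNReal.tsum_add]
  refine ENNReal.tsum_le_tsum fun α => ?_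
  rw [← add_mul, map_add]
  gcongr
  exact enorm_add_le _ _

theorem wnorm_zero (s : ℕ) : wnorm s (0 : MvPowerSeries (Fin n) ℂ) = 0 := by
  simp [wnorm]

theorem wnorm_sum_le (s : ℕ) {ι : Type*} (t : Finset ι) (a : ι → MvPowerSeries (Fin n) ℂ) :
    wnorm s (∑ i ∈ t, a i) ≤ ∑ i ∈ t, wnorm s (a i) := by
  induction t using Finset.cons_induction with
  | empty => simp [wnorm_zero]
  | cons i t hi ih =>
    rw [Finset.sum_cons, Finset.sum_cons]
    exact (wnorm_add_le s _ _).trans (by gcongr)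

/-- The weight is multiplicative in the exponent, so this is the convolution inequality for `ℓ¹`. -/
theorem wnorm_mul_le (s : ℕ) (a b : MvPowerSeries (Fin n) ℂ) :
    wnorm s (a * b) ≤ wnorm s a * wnorm s b := by
  have h1 : wnorm s a * wnorm s b = ∑' p : (Fin n →₀ ℕ) × (Fin n →₀ ℕ),
      (‖a.coeff p.1‖ₑ * wt s p.1) * (‖b.coeff p.2‖ₑ * wt s p.2) := by
    rw [ENNReal.tsum_prod (f := fun α β => (‖a.coeff α‖ₑ * wt s α) * (‖b.coeff β‖ₑ * wt s β)),
      wnorm, wnorm, ← ENNReal.tsum_mul_right]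
    exact tsum_congr fun _ => ENNReal.tsum_mul_left.symm
  rw [h1, ← Finset.HasAntidiagonal.sigmaAntidiagonalEquivProd.tsum_eq, ENNReal.tsum_sigma']
  refine ENNReal.tsum_le_tsum fun γ => ?_
  rw [tsum_fintype, MvPowerSeries.coeff_mul]
  calc _ ≤ (∑ p ∈ Finset.HasAntidiagonal.antidiagonal γ, ‖a.coeff p.1 * b.coeff p.2‖ₑ) *
        wt s γ := by
        gcongr
        exact enorm_sum_le _ _
    _ = ∑ p ∈ Finset.HasAntidiagonal.antidiagonal γ,
        (‖a.coeff p.1‖ₑ * wt s p.1) * (‖b.coeff p.2‖ₑ * wt s p.2) := by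
        rw [Finset.sum_mul]
        refine Finset.sum_congr rfl fun p hp => ?_
        rw [← Finset.HasAntidiagonal.mem_antidiagonal.1 hp, wt_add, enorm_mul, mul_mul_mul_comm]
    _ = _ := (Finset.sum_coe_sort _ fun p : (Fin n →₀ ℕ) × (Fin n →₀ ℕ) =>
        (‖a.coeff p.1‖ₑ * wt s p.1) * (‖b.coeff p.2‖ₑ * wt s p.2)).symm

theorem conv_of_wnorm_ne_top {s : ℕ} {a : MvPowerSeries (Fin n) ℂ} (h : wnorm s a ≠ ∞) :
    Conv a := by
  have hs := ENNReal.summable_toReal h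
  have hp : (0 : ℝ) < Nat.nth Nat.Prime n := by exact_mod_cast (Nat.prime_nth_prime n).pos
  refine ⟨((Nat.nth Nat.Prime n : ℝ)⁻¹) ^ s, by positivity, ?_⟩
  refine Summable.of_nonneg_of_le (fun _ => by positivity) (fun α => ?_) hs
  rw [ENNReal.toReal_mul, toReal_enorm, wt, ENNReal.toReal_pow, ENNReal.toReal_inv,
    ENNReal.toReal_natCast, ← pow_mul, mul_comm s, pow_mul, inv_pow]
  have h1 : (0 : ℝ) < primeCode α := by exact_mod_cast primeCode_pos α
  gcongr
  exact_mod_cast primeCode_le α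

theorem Conv.exists_wnorm_ne_top {a : MvPowerSeries (Fin n) ℂ} (h : Conv a) :
    ∃ s, wnorm s a ≠ ∞ := by
  obtain ⟨ρ, hρ, h⟩ := h
  obtain ⟨s, hs⟩ := exists_pow_lt_of_lt_one hρ (by norm_num : (2⁻¹ : ℝ) < 1)
  have hle : ∀ α : Fin n →₀ ℕ, wt s α ≤ ENNReal.ofReal (ρ ^ α.degree) := by
    intro α
    have h1 : (0 : ℝ) < primeCode α := by exact_mod_cast primeCode_pos α
    have h2 : ((2 : ℝ) ^ α.degree) ≤ primeCode α := by
      exact_mod_cast two_pow_degree_le_primeCode α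
    rw [← ENNReal.ofReal_toReal (wt_ne_top s α)]
    refine ENNReal.ofReal_le_ofReal ?_
    rw [wt, ENNReal.toReal_pow, ENNReal.toReal_inv, ENNReal.toReal_natCast]
    calc ((primeCode α : ℝ)⁻¹) ^ s ≤ (((2 : ℝ) ^ α.degree)⁻¹) ^ s := by gcongr
      _ = ((2⁻¹ : ℝ) ^ s) ^ α.degree := by rw [← inv_pow, ← pow_mul, ← pow_mul, mul_comm]
      _ ≤ _ := by gcongr
  refine ⟨s, ne_top_of_le_ne_top (Summable.tsum_ofReal_ne_top h)
    (ENNReal.tsum_le_tsum fun α => ?_)⟩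
  rw [ENNReal.ofReal_mul (norm_nonneg _), ofReal_norm]
  gcongr
  exact hle α

/-- Let `N` be the code of `β`. Codes are integers, so all exponents of `b` have code at least `N +
1`. Raising `s` by `m` multiplies the norm of `b` by at most `(N + 1)^{-m}` but the weight of `β` by
exactly `N^{-m}`, and the ratio tends to zero. -/
theorem exists_wnorm_le_mul_wt {b : MvPowerSeries (Fin n) ℂ} (hb : Conv b) (β : Fin n →₀ ℕ)
    (h : ∀ α, primeCode α ≤ primeCode β → b.coeff α = 0) {ε : ℝ≥0∞} (hε : ε ≠ 0) :
    ∃ s₁, ∀ s, s₁ ≤ s → wnorm s b ≤ ε * wt s β := by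
  obtain ⟨s₀, hs₀⟩ := hb.exists_wnorm_ne_top
  let N : ℝ≥0∞ := primeCode β
  have hN0 : N ≠ 0 := primeCode_cast_ne_zero β
  have hNt : N ≠ ∞ := ENNReal.natCast_ne_top _
  have hq : N / (N + 1) < 1 := by
    rw [ENNReal.div_lt_iff (Or.inl (by simp)) (Or.inl (by simpa)), one_mul]
    exact ENNReal.lt_add_right hNt one_ne_zero
  have hlim : Tendsto (fun m : ℕ => wnorm s₀ b * N ^ s₀ * (N / (N + 1)) ^ m) atTop (𝓝 0) := by
    have := ENNReal.Tendsto.const_mul (a := wnorm s₀ b * N ^ s₀)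
      (ENNReal.tendsto_pow_atTop_nhds_zero_of_lt_one hq)
      (Or.inr (ENNReal.mul_ne_top hs₀ (ENNReal.pow_ne_top hNt)))
    simpa using this
  obtain ⟨m₀, hm₀⟩ := eventually_atTop.1 (hlim.eventually_le_const (pos_iff_ne_zero.2 hε))
  refine ⟨s₀ + m₀, fun s hs => ?_⟩
  obtain ⟨m, rfl⟩ := exists_add_of_le ((Nat.le_add_right s₀ m₀).trans hs)
  have h1 : wnorm (s₀ + m) b ≤ wnorm s₀ b * ((N + 1)⁻¹) ^ m := by
    rw [wnorm, wnorm, ← ENNReal.tsum_mul_right]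
    refine ENNReal.tsum_le_tsum fun α => ?_
    by_cases hα : primeCode α ≤ primeCode β
    · simp [h α hα]
    rw [wt, pow_add, ← mul_assoc, wt]
    gcongr
    change (primeCode β : ℝ≥0∞) + 1 ≤ primeCode α
    exact_mod_cast Nat.succ_le_of_lt (not_le.1 hα)
  refine h1.trans ?_
  have h2 : wnorm s₀ b * ((N + 1)⁻¹) ^ m =
      wnorm s₀ b * N ^ s₀ * (N / (N + 1)) ^ m * wt (s₀ + m) β := by
    have e1 : N ^ s₀ * (N⁻¹) ^ s₀ = 1 := by
      rw [← mul_pow, ENNReal.mul_inv_cancel hN0 hNt, one_pow]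
    have e2 : N ^ m * (N⁻¹) ^ m = 1 := by
      rw [← mul_pow, ENNReal.mul_inv_cancel hN0 hNt, one_pow]
    rw [wt, ENNReal.div_eq_inv_mul, mul_pow, pow_add]
    change _ = wnorm s₀ b * N ^ s₀ * (((N + 1)⁻¹) ^ m * N ^ m) * ((N⁻¹) ^ s₀ * (N⁻¹) ^ m)
    calc _ = wnorm s₀ b * ((N + 1)⁻¹) ^ m * (N ^ s₀ * (N⁻¹) ^ s₀) * (N ^ m * (N⁻¹) ^ m) := by
          rw [e1, e2, mul_one, mul_one]
      _ = _ := by ring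
  rw [h2]
  gcongr
  exact hm₀ m (by omega)

theorem conv_monomial (α : Fin n →₀ ℕ) (c : ℂ) : Conv (MvPowerSeries.monomial α c) := by
  classical
  refine ⟨1, one_pos, summable_of_ne_finset_zero (s := {α}) fun β hβ => ?_⟩
  rw [MvPowerSeries.coeff_monomial_ne (by simpa using hβ)]
  simp

theorem Conv.sub {a b : MvPowerSeries (Fin n) ℂ} (ha : Conv a) (hb : Conv b) : Conv (a - b) := by
  have := ha.add (hb.smul (-1))
  simpa [sub_eq_add_neg] using this

/-! ### Division by an ideal and closedness of ideals -/

/-- A set of convergent power series that is an ideal of the ring of convergent power series. -/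
structure IsConvIdeal (J : Set (MvPowerSeries (Fin n) ℂ)) : Prop where
  conv : ∀ a ∈ J, Conv a
  zero_mem : 0 ∈ J
  add_mem : ∀ a ∈ J, ∀ b ∈ J, a + b ∈ J
  mul_mem : ∀ a, Conv a → ∀ b ∈ J, a * b ∈ J

theorem IsConvIdeal.smul_mem {J : Set (MvPowerSeries (Fin n) ℂ)} (hJ : IsConvIdeal J) (c : ℂ)
    {a : MvPowerSeries (Fin n) ℂ} (ha : a ∈ J) : c • a ∈ J := by
  have := hJ.mul_mem _ (conv_monomial 0 c) a ha
  rwa [MvPowerSeries.monomial_zero_eq_C_apply, ← MvPowerSeries.smul_eq_C_mul] at this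

theorem IsConvIdeal.sub_mem {J : Set (MvPowerSeries (Fin n) ℂ)} (hJ : IsConvIdeal J)
    {a b : MvPowerSeries (Fin n) ℂ} (ha : a ∈ J) (hb : b ∈ J) : a - b ∈ J := by
  have := hJ.add_mem a ha _ (hJ.smul_mem (-1) hb)
  simpa [sub_eq_add_neg] using this

theorem IsConvIdeal.sum_mem {J : Set (MvPowerSeries (Fin n) ℂ)} (hJ : IsConvIdeal J)
    {ι : Type*} (t : Finset ι) (a : ι → MvPowerSeries (Fin n) ℂ) (ha : ∀ i ∈ t, a i ∈ J) :
    ∑ i ∈ t, a i ∈ J := by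
  induction t using Finset.cons_induction with
  | empty => simpa using hJ.zero_mem
  | cons i t hi ih =>
    rw [Finset.sum_cons]
    exact hJ.add_mem _ (ha i (by simp)) _ (ih fun j hj => ha j (by simp [hj]))

/-- The exponents of the initial monomials of the elements of `J`. -/
def initialExps (J : Set (MvPowerSeries (Fin n) ℂ)) : Set (Fin n →₀ ℕ) :=
  {β | ∃ g ∈ J, g.coeff β = 1 ∧ ∀ α, primeCode α < primeCode β → g.coeff α = 0}

open Classical in
/-- The part of `a` whose exponents lie in `P`, divided by `z^μ`. -/
def partQuot (P : Set (Fin n →₀ ℕ)) (μ : Fin n →₀ ℕ) (a : MvPowerSeries (Fin n) ℂ) :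
    MvPowerSeries (Fin n) ℂ :=
  fun α => if α + μ ∈ P then a.coeff (α + μ) else 0

open Classical in
theorem coeff_partQuot (P : Set (Fin n →₀ ℕ)) (μ α : Fin n →₀ ℕ) (a : MvPowerSeries (Fin n) ℂ) :
    (partQuot P μ a).coeff α = if α + μ ∈ P then a.coeff (α + μ) else 0 := rfl

open Classical in
theorem wnorm_partQuot_le (s : ℕ) (P : Set (Fin n →₀ ℕ)) (μ : Fin n →₀ ℕ)
    (a : MvPowerSeries (Fin n) ℂ) :
    wnorm s (partQuot P μ a) * wt s μ ≤
      ∑' β, if β ∈ P then ‖a.coeff β‖ₑ * wt s β else 0 := by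
  rw [wnorm, ← ENNReal.tsum_mul_right]
  refine le_trans (ENNReal.tsum_le_tsum fun α => ?_)
    (ENNReal.tsum_comp_le_tsum_of_injective (add_left_injective μ) _)
  rw [coeff_partQuot, mul_assoc, ← wt_add]
  split_ifs <;> simp

theorem wnorm_partQuot_ne_top {s : ℕ} (P : Set (Fin n →₀ ℕ)) (μ : Fin n →₀ ℕ)
    {a : MvPowerSeries (Fin n) ℂ} (ha : wnorm s a ≠ ∞) : wnorm s (partQuot P μ a) ≠ ∞ := by
  have h1 : wnorm s (partQuot P μ a) * wt s μ ≤ wnorm s a := by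
    refine (wnorm_partQuot_le s P μ a).trans (ENNReal.tsum_le_tsum fun β => ?_)
    split_ifs <;> simp
  intro h
  rw [h, ENNReal.top_mul (wt_ne_zero s μ)] at h1
  exact ha (top_le_iff.1 h1)

/-- Formal division of `a` by the series `g μ` with initial exponents `μ ∈ M`: the exponents in
`P μ` are divided by the initial monomial of `g μ`, those in `P'` are kept. -/
def divSum (M : Finset (Fin n →₀ ℕ)) (P : (Fin n →₀ ℕ) → Set (Fin n →₀ ℕ))
    (P' : Set (Fin n →₀ ℕ)) (g : (Fin n →₀ ℕ) → MvPowerSeries (Fin n) ℂ)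
    (a : MvPowerSeries (Fin n) ℂ) : MvPowerSeries (Fin n) ℂ :=
  ∑ μ ∈ M, partQuot (P μ) μ a * g μ + partQuot P' 0 a

theorem hasSum_coeff_divSum (M : Finset (Fin n →₀ ℕ)) (P : (Fin n →₀ ℕ) → Set (Fin n →₀ ℕ))
    (P' : Set (Fin n →₀ ℕ)) (g : (Fin n →₀ ℕ) → MvPowerSeries (Fin n) ℂ)
    {b : ℕ → MvPowerSeries (Fin n) ℂ} {A : MvPowerSeries (Fin n) ℂ}
    (h : ∀ α, HasSum (fun m => (b m).coeff α) (A.coeff α)) (γ : Fin n →₀ ℕ) :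
    HasSum (fun m => (divSum M P P' g (b m)).coeff γ) ((divSum M P P' g A).coeff γ) := by
  have hp : ∀ Q μ α, HasSum (fun m => (partQuot Q μ (b m)).coeff α)
      ((partQuot Q μ A).coeff α) := by
    intro Q μ α
    simp only [coeff_partQuot]
    split_ifs
    · exact h _
    · exact hasSum_zero
  simp only [divSum, map_add, map_sum, MvPowerSeries.coeff_mul]
  exact (hasSum_sum fun μ _ => hasSum_sum fun p _ => (hp _ _ _).mul_right _).add (hp _ _ _)

/-- Every exponent lies in `P'` or in exactly one `P μ`, so dividing by pure monomials and
multiplying back changes nothing. This is the model of which the true division is a perturbation. -/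
theorem eq_divSum_monomial {M : Finset (Fin n →₀ ℕ)} {P : (Fin n →₀ ℕ) → Set (Fin n →₀ ℕ)}
    {P' : Set (Fin n →₀ ℕ)} (hP : ∀ β ∉ P', ∃ μ ∈ M, μ ≤ β ∧ ∀ ν, β ∈ P ν ↔ ν = μ)
    (hP' : ∀ β ∈ P', ∀ ν, β ∉ P ν) (a : MvPowerSeries (Fin n) ℂ) :
    divSum M P P' (fun μ => MvPowerSeries.monomial μ 1) a = a := by
  classical
  refine MvPowerSeries.ext fun β => ?_
  rw [divSum, map_add, map_sum, coeff_partQuot, add_zero]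
  simp only [MvPowerSeries.coeff_mul_monomial, mul_one, coeff_partQuot]
  have h1 : ∀ μ, (if μ ≤ β then if β - μ + μ ∈ P μ then a.coeff (β - μ + μ) else 0 else 0) =
      if μ ≤ β ∧ β ∈ P μ then a.coeff β else 0 := by
    intro μ
    by_cases h : μ ≤ β
    · simp [h, tsub_add_cancel_of_le h]
    · simp [h]
  simp only [h1]
  by_cases hβ : β ∈ P'
  · rw [Finset.sum_eq_zero fun μ _ => if_neg fun h => hP' β hβ μ h.2, if_pos hβ, zero_add]
  · obtain ⟨μ, hμM, hμ, huniq⟩ := hP β hβ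
    rw [Finset.sum_eq_single μ (fun ν _ hν => if_neg fun h => hν ((huniq ν).1 h.2))
      (fun h => absurd hμM h), if_pos ⟨hμ, (huniq μ).2 rfl⟩, if_neg hβ, add_zero]

/-- By comparison with the monomial case, the error is the sum of the quotients times `z^μ - g μ`.
The factor `wt s μ` in the size of the latter compensates the division by `z^μ`, and the parts of
`a` are disjoint. -/
theorem wnorm_sub_divSum_le {M : Finset (Fin n →₀ ℕ)} {P : (Fin n →₀ ℕ) → Set (Fin n →₀ ℕ)}
    {P' : Set (Fin n →₀ ℕ)} (hP : ∀ β ∉ P', ∃ μ ∈ M, μ ≤ β ∧ ∀ ν, β ∈ P ν ↔ ν = μ)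
    (hP' : ∀ β ∈ P', ∀ ν, β ∉ P ν) {g : (Fin n →₀ ℕ) → MvPowerSeries (Fin n) ℂ} {s : ℕ}
    {ε : ℝ≥0∞} (hg : ∀ μ ∈ M, wnorm s (MvPowerSeries.monomial μ 1 - g μ) ≤ ε * wt s μ)
    (a : MvPowerSeries (Fin n) ℂ) : wnorm s (a - divSum M P P' g a) ≤ ε * wnorm s a := by
  classical
  have h1 : a - divSum M P P' g a =
      ∑ μ ∈ M, partQuot (P μ) μ a * (MvPowerSeries.monomial μ 1 - g μ) := by
    conv_lhs => enter [1]; rw [← eq_divSum_monomial hP hP' a]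
    simp [divSum, mul_sub]
  rw [h1]
  calc _ ≤ ∑ μ ∈ M, wnorm s (partQuot (P μ) μ a) * (ε * wt s μ) := by
        refine (wnorm_sum_le _ _ _).trans (Finset.sum_le_sum fun μ hμ => ?_)
        refine (wnorm_mul_le _ _ _).trans ?_
        gcongr
        exact hg μ hμ
    _ = ε * ∑ μ ∈ M, wnorm s (partQuot (P μ) μ a) * wt s μ := by
        rw [Finset.mul_sum]
        exact Finset.sum_congr rfl fun μ _ => by ring
    _ ≤ ε * ∑ μ ∈ M, ∑' β, (if β ∈ P μ then ‖a.coeff β‖ₑ * wt s β else 0) := by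
        gcongr with μ
        exact wnorm_partQuot_le s (P μ) μ a
    _ = ε * ∑' β, ∑ μ ∈ M, (if β ∈ P μ then ‖a.coeff β‖ₑ * wt s β else 0) := by
        rw [Summable.tsum_finsetSum fun _ _ => ENNReal.summable]
    _ ≤ _ := by
        refine mul_le_mul_right (ENNReal.tsum_le_tsum fun β => ?_) ε
        by_cases hβ : β ∈ P'
        · rw [Finset.sum_eq_zero fun μ _ => if_neg (hP' β hβ μ)]
          exact zero_le
        · obtain ⟨μ, hμM, hμ, huniq⟩ := hP β hβ
          rw [Finset.sum_eq_single μ (fun ν _ hν => if_neg fun h => hν ((huniq ν).1 h))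
            (fun h => absurd hμM h), if_pos ((huniq μ).2 rfl)]

/-- The map `divSum` differs from the identity by an operator of norm at most one half, so it is
inverted by the Neumann series `A = ∑ T^m a`. -/
theorem exists_divSum_eq {M : Finset (Fin n →₀ ℕ)} {P : (Fin n →₀ ℕ) → Set (Fin n →₀ ℕ)}
    {P' : Set (Fin n →₀ ℕ)} (hP : ∀ β ∉ P', ∃ μ ∈ M, μ ≤ β ∧ ∀ ν, β ∈ P ν ↔ ν = μ)
    (hP' : ∀ β ∈ P', ∀ ν, β ∉ P ν) {g : (Fin n →₀ ℕ) → MvPowerSeries (Fin n) ℂ} {s : ℕ}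
    (hg : ∀ μ ∈ M, wnorm s (MvPowerSeries.monomial μ 1 - g μ) ≤ 2⁻¹ * wt s μ)
    {a : MvPowerSeries (Fin n) ℂ} (ha : wnorm s a ≠ ∞) :
    ∃ A, wnorm s A ≠ ∞ ∧ divSum M P P' g A = a := by
  let T : MvPowerSeries (Fin n) ℂ → MvPowerSeries (Fin n) ℂ := fun x => x - divSum M P P' g x
  have hT : ∀ m, wnorm s (T^[m] a) ≤ 2⁻¹ ^ m * wnorm s a := by
    intro m
    induction m with
    | zero => simp
    | succ m ih =>
      rw [Function.iterate_succ_apply', pow_succ', mul_assoc]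
      refine (wnorm_sub_divSum_le hP hP' hg _).trans ?_
      gcongr
  have hsum : ∑' m, wnorm s (T^[m] a) ≠ ∞ := by
    refine ne_top_of_le_ne_top ?_ (ENNReal.tsum_le_tsum hT)
    rw [ENNReal.tsum_mul_right, ENNReal.tsum_geometric, ENNReal.one_sub_inv_two, inv_inv]
    exact ENNReal.mul_ne_top (by simp) ha
  have hswap : ∑' α, (∑' m, ‖(T^[m] a).coeff α‖ₑ) * wt s α = ∑' m, wnorm s (T^[m] a) := by
    simp only [wnorm, ← ENNReal.tsum_mul_right]
    exact ENNReal.tsum_comm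
  have hfin : ∀ α, ∑' m, ‖(T^[m] a).coeff α‖ₑ ≠ ∞ := by
    intro α h
    have := ENNReal.ne_top_of_tsum_ne_top (hswap ▸ hsum) α
    rw [h, ENNReal.top_mul (wt_ne_zero s α)] at this
    exact this rfl
  have hs : ∀ α, Summable fun m => (T^[m] a).coeff α := by
    intro α
    refine Summable.of_nnnorm (ENNReal.tsum_coe_ne_top_iff_summable.1 ?_)
    exact hfin α
  let A : MvPowerSeries (Fin n) ℂ := fun α => ∑' m, (T^[m] a).coeff α
  have hA : ∀ α, HasSum (fun m => (T^[m] a).coeff α) (A.coeff α) := fun α => (hs α).hasSum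
  refine ⟨A, ne_top_of_le_ne_top hsum ?_, MvPowerSeries.ext fun γ => ?_⟩
  · rw [← hswap]
    refine ENNReal.tsum_le_tsum fun α => ?_
    gcongr
    exact enorm_tsum_le_tsum_enorm
  · have h1 := hasSum_coeff_divSum M P P' g hA γ
    have h2 : (fun m => (divSum M P P' g (T^[m] a)).coeff γ) =
        fun m => (T^[m] a).coeff γ - (T^[m + 1] a).coeff γ := by
      funext m
      rw [Function.iterate_succ_apply']
      simp [T]
    rw [h2] at h1
    -- The series telescopes to its term of index zero, namely `a`.
    have h3 := (hA γ).sub ((hasSum_nat_add_iff' 1).2 (hA γ))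
    simpa using h1.unique h3

/-- Division with remainder by an ideal of convergent power series. -/
theorem IsConvIdeal.exists_division {J : Set (MvPowerSeries (Fin n) ℂ)} (hJ : IsConvIdeal J)
    {a : MvPowerSeries (Fin n) ℂ} (ha : Conv a) :
    ∃ b ∈ J, ∃ r, a = b + r ∧ ∀ β ∈ initialExps J, r.coeff β = 0 := by
  classical
  let L := initialExps J
  -- Dickson's lemma: antichains of exponents are finite.
  have hMfin : {μ | Minimal (· ∈ L) μ}.Finite :=
    (setOfPred_minimal_antichain _).finite_of_partiallyWellOrderedOn
      (Set.isPWO_of_wellQuasiOrderedLE _)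
  let M := hMfin.toFinset
  -- Choosing one minimal exponent below each `β ∈ L` partitions `L` into the pieces `P μ`.
  have hι : ∀ β, ∃ μ, β ∈ L → μ ∈ M ∧ μ ≤ β := by
    intro β
    by_cases hβ : β ∈ L
    · obtain ⟨μ, hμ, hmin⟩ := exists_minimal_le_of_wellFoundedLT (· ∈ L) β hβ
      exact ⟨μ, fun _ => ⟨by simpa [M] using hmin, hμ⟩⟩
    · exact ⟨0, fun h => absurd h hβ⟩
  choose ι hι using hι
  have hg : ∀ μ, ∃ g, μ ∈ M → g ∈ J ∧ g.coeff μ = 1 ∧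
      ∀ α, primeCode α < primeCode μ → g.coeff α = 0 := by
    intro μ
    by_cases hμ : μ ∈ M
    · have : Minimal (· ∈ L) μ := by simpa [M] using hμ
      obtain ⟨g, h⟩ := this.prop
      exact ⟨g, fun _ => h⟩
    · exact ⟨0, fun h => absurd h hμ⟩
  choose g hg using hg
  let P : (Fin n →₀ ℕ) → Set (Fin n →₀ ℕ) := fun μ => {β | β ∈ L ∧ ι β = μ}
  have hP : ∀ β ∉ Lᶜ, ∃ μ ∈ M, μ ≤ β ∧ ∀ ν, β ∈ P ν ↔ ν = μ := by
    intro β hβ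
    have hβL : β ∈ L := not_not.1 hβ
    refine ⟨ι β, (hι β hβL).1, (hι β hβL).2, fun ν => ⟨fun h => h.2.symm, fun h => ⟨hβL, h.symm⟩⟩⟩
  have hP' : ∀ β ∈ Lᶜ, ∀ ν, β ∉ P ν := fun β hβ ν h => hβ h.1
  have hs : ∀ μ, ∃ s₁, μ ∈ M → ∀ s, s₁ ≤ s →
      wnorm s (MvPowerSeries.monomial μ 1 - g μ) ≤ 2⁻¹ * wt s μ := by
    intro μ
    by_cases hμ : μ ∈ M
    · obtain ⟨hgJ, hg1, hg0⟩ := hg μ hμ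
      have h0 : ∀ α, primeCode α ≤ primeCode μ →
          (MvPowerSeries.monomial μ 1 - g μ).coeff α = 0 := by
        intro α hα
        rw [map_sub]
        rcases hα.lt_or_eq with h | h
        · have hne : α ≠ μ := by
            rintro rfl
            exact h.false
          rw [hg0 α h, MvPowerSeries.coeff_monomial_ne hne, sub_zero]
        · rw [primeCode_injective h, hg1, MvPowerSeries.coeff_monomial_same, sub_self]
      obtain ⟨s₁, h⟩ := exists_wnorm_le_mul_wt ((conv_monomial μ 1).sub (hJ.conv _ hgJ)) μ h0
        (ε := 2⁻¹) (by simp)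
      exact ⟨s₁, fun _ => h⟩
    · exact ⟨0, fun h => absurd h hμ⟩
  choose s₁ hs₁ using hs
  obtain ⟨s₀, hs₀⟩ := ha.exists_wnorm_ne_top
  let s := max s₀ (M.sup s₁)
  obtain ⟨A, hA, hAa⟩ := exists_divSum_eq hP hP' (g := g) (s := s)
    (fun μ hμ => hs₁ μ hμ s ((Finset.le_sup hμ).trans (le_max_right _ _)))
    (ne_top_of_le_ne_top hs₀ (wnorm_anti (le_max_left _ _) a))
  refine ⟨_, hJ.sum_mem M (fun μ => partQuot (P μ) μ A * g μ) fun μ hμ =>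
    hJ.mul_mem _ (conv_of_wnorm_ne_top (wnorm_partQuot_ne_top _ _ hA)) _ (hg μ hμ).1,
    partQuot Lᶜ 0 A, hAa.symm, fun β hβ => ?_⟩
  rw [coeff_partQuot, add_zero, if_neg]
  exact fun h => h hβ

/-- Ideals of convergent power series are closed in the topology of coefficientwise
convergence. -/
theorem IsConvIdeal.mem_of_forall_finset {J : Set (MvPowerSeries (Fin n) ℂ)} (hJ : IsConvIdeal J)
    {a : MvPowerSeries (Fin n) ℂ} (ha : Conv a)
    (h : ∀ T : Finset (Fin n →₀ ℕ), ∃ g ∈ J, ∀ α ∈ T, g.coeff α = a.coeff α) : a ∈ J := by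
  obtain ⟨b, hb, r, rfl, hr⟩ := hJ.exists_division ha
  suffices r = 0 by rwa [this, add_zero]
  by_contra hne
  obtain ⟨β₀, hβ₀⟩ := (MvPowerSeries.ne_zero_iff_exists_coeff_ne_zero r).1 hne
  obtain ⟨β, hβ, hmin⟩ := exists_minimalFor_of_wellFoundedLT (fun α => r.coeff α ≠ 0) primeCode
    ⟨β₀, hβ₀⟩
  -- Here `β` is the lowest exponent of the remainder. An element of `J` agreeing with `b + r` up to
  -- `β` makes `g - b ∈ J` agree with `r` there, so `β` is an initial exponent, where `r` must
  -- vanish.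
  obtain ⟨g, hg, hgr⟩ := h (finite_primeCode_le (primeCode β)).toFinset
  have hgr' : ∀ α, primeCode α ≤ primeCode β → (g - b).coeff α = r.coeff α := by
    intro α hα
    rw [map_sub, hgr α (by simpa using hα), map_add, add_sub_cancel_left]
  refine hβ (hr β ⟨(r.coeff β)⁻¹ • (g - b), hJ.smul_mem _ (hJ.sub_mem hg hb), ?_, fun α hα => ?_⟩)
  · rw [MvPowerSeries.coeff_smul, hgr' β le_rfl, inv_mul_cancel₀ hβ]
  · rw [MvPowerSeries.coeff_smul, hgr' α hα.le]
    by_contra h0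
    exact (hmin (fun h => h0 (by rw [h, mul_zero])) hα.le).not_gt hα

/-! ### Ideals of germs are closed -/

theorem GermMem.congr {I : Ideal (HolGerm n)} {f g : Cn n → ℂ} (hf : GermMem I f)
    (hfg : f =ᶠ[𝓝 0] g) : GermMem I g := by
  obtain ⟨h, hI⟩ := hf
  refine ⟨h.congr hfg, ?_⟩
  have : germ g (h.congr hfg) = germ f h := Subtype.ext (Germ.coe_eq.2 hfg.symm)
  rwa [this]

theorem GermMem.zero {I : Ideal (HolGerm n)} : GermMem I (0 : Cn n → ℂ) :=
  ⟨analyticAt_const, I.zero_mem⟩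

theorem GermMem.add {I : Ideal (HolGerm n)} {f g : Cn n → ℂ} (hf : GermMem I f)
    (hg : GermMem I g) : GermMem I (f + g) := by
  obtain ⟨h, hI⟩ := hf
  obtain ⟨h', hI'⟩ := hg
  exact ⟨h.add h', I.add_mem hI hI'⟩

theorem GermMem.mul {I : Ideal (HolGerm n)} {f g : Cn n → ℂ} (hf : AnalyticAt ℂ f 0)
    (hg : GermMem I g) : GermMem I (f * g) := by
  obtain ⟨h', hI'⟩ := hg
  exact ⟨hf.mul h', I.mul_mem_left (germ f hf) hI'⟩

theorem GermMem.const_smul {I : Ideal (HolGerm n)} {f : Cn n → ℂ} (hf : GermMem I f) (c : ℂ) :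
    GermMem I (c • f) :=
  GermMem.mul (f := fun _ => c) analyticAt_const hf

theorem isConvIdeal_setOf_germMem (I : Ideal (HolGerm n)) :
    IsConvIdeal {a | Conv a ∧ GermMem I (sumSeries a)} where
  conv _ h := h.1
  zero_mem := ⟨conv_zero, GermMem.zero.congr (Eventually.of_forall fun z => by simp [sumSeries])⟩
  add_mem a ha b hb :=
    ⟨ha.1.add hb.1, (ha.2.add hb.2).congr (ha.1.sumSeries_add hb.1).symm⟩
  mul_mem a ha b hb :=
    ⟨ha.mul hb.1, (hb.2.mul ha.analyticAt).congr (ha.sumSeries_mul hb.1).symm⟩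

theorem germMem_of_forall_finset {I : Ideal (HolGerm n)} {f : Cn n → ℂ} (hf : AnalyticAt ℂ f 0)
    (h : ∀ T : Finset (Fin n →₀ ℕ), ∃ g, GermMem I g ∧
      ∀ α ∈ T, taylorCoeff α g 0 = taylorCoeff α f 0) : GermMem I f := by
  have h1 := (isConvIdeal_setOf_germMem I).mem_of_forall_finset (conv_taylorSeries hf) fun T => by
    obtain ⟨g, hg, hgT⟩ := h T
    have hga : AnalyticAt ℂ g 0 := hg.1
    exact ⟨taylorSeries g, ⟨conv_taylorSeries hga,
      hg.congr (eventuallyEq_sumSeries_taylorSeries hga)⟩, hgT⟩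
  exact h1.2.congr (eventuallyEq_sumSeries_taylorSeries hf).symm

/-! ### The pairing and the `ξ`-Bergman kernel -/

theorem pairing_eq_tsum_finsupp (ξ : (Fin n → ℕ) → ℂ) (f : Cn n → ℂ) (z : Cn n) :
    pairing ξ f z = ∑' α : Fin n →₀ ℕ, ξ α * taylorCoeff α f z :=
  ((Finsupp.equivFunOnFinite : (Fin n →₀ ℕ) ≃ (Fin n → ℕ)).tsum_eq
    fun α => ξ α * taylorCoeff α f z).symm

theorem summable_of_mem_ellOne {ξ : (Fin n → ℕ) → ℂ} (hξ : ξ ∈ ellOne n) {ρ : ℝ} (hρ : 0 < ρ) :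
    Summable fun α : Fin n →₀ ℕ => ‖ξ α‖ * ρ ^ α.degree := by
  have := (Finsupp.equivFunOnFinite : (Fin n →₀ ℕ) ≃ (Fin n → ℕ)).summable_iff.2 (hξ ρ hρ)
  refine this.congr fun α => ?_
  rw [Finsupp.degree_eq_sum]
  rfl

/-- The Taylor coefficients grow at most like `ρ^{-|α|}`, while `ξ` is summable against every
geometric weight. -/
theorem summable_pairing {ξ : (Fin n → ℕ) → ℂ} (hξ : ξ ∈ ellOne n) {f : Cn n → ℂ}
    (hf : AnalyticAt ℂ f 0) : Summable fun α : Fin n →₀ ℕ => ξ α * taylorCoeff α f 0 := by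
  obtain ⟨ρ, hρ, h⟩ := conv_taylorSeries hf
  refine Summable.of_norm (Summable.of_nonneg_of_le (fun _ => norm_nonneg _) (fun α => ?_)
    ((summable_of_mem_ellOne hξ (inv_pos.2 hρ)).mul_right
      (∑' α, ‖(taylorSeries f).coeff α‖ * ρ ^ α.degree)))
  have h1 := Summable.le_tsum h α fun _ _ => by positivity
  rw [coeff_taylorSeries] at h1
  rw [norm_mul]
  calc _ = ‖ξ α‖ * ρ⁻¹ ^ α.degree * (‖taylorCoeff α f 0‖ * ρ ^ α.degree) := by
        rw [inv_pow]
        field_simp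
    _ ≤ _ := by gcongr

theorem pairing_sub {ξ : (Fin n → ℕ) → ℂ} (hξ : ξ ∈ ellOne n) {f g : Cn n → ℂ}
    (hf : AnalyticAt ℂ f 0) (hg : AnalyticAt ℂ g 0) :
    pairing ξ (f - g) 0 = pairing ξ f 0 - pairing ξ g 0 := by
  simp only [pairing_eq_tsum_finsupp]
  rw [← (summable_pairing hξ hf).tsum_sub (summable_pairing hξ hg)]
  refine tsum_congr fun α => ?_
  have := congrArg (MvPowerSeries.coeff α) (taylorSeries_sub hf hg)
  rw [map_sub] at this
  simp only [coeff_taylorSeries] at this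
  rw [this, mul_sub]

theorem taylorCoeff_smul {f : Cn n → ℂ} (hf : AnalyticAt ℂ f 0) (c : ℂ) (α : Fin n →₀ ℕ) :
    taylorCoeff α (c • f) 0 = c * taylorCoeff α f 0 := by
  have := congrArg (MvPowerSeries.coeff α) (taylorSeries_smul hf c)
  rwa [MvPowerSeries.coeff_smul] at this

theorem taylorCoeff_add {f g : Cn n → ℂ} (hf : AnalyticAt ℂ f 0) (hg : AnalyticAt ℂ g 0)
    (α : Fin n →₀ ℕ) : taylorCoeff α (f + g) 0 = taylorCoeff α f 0 + taylorCoeff α g 0 := by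
  have := congrArg (MvPowerSeries.coeff α) (taylorSeries_add hf hg)
  rwa [map_add] at this

theorem taylorCoeff_sub {f g : Cn n → ℂ} (hf : AnalyticAt ℂ f 0) (hg : AnalyticAt ℂ g 0)
    (α : Fin n →₀ ℕ) : taylorCoeff α (f - g) 0 = taylorCoeff α f 0 - taylorCoeff α g 0 := by
  have := congrArg (MvPowerSeries.coeff α) (taylorSeries_sub hf hg)
  rwa [map_sub] at this

theorem pairing_smul (ξ : (Fin n → ℕ) → ℂ) {f : Cn n → ℂ} (hf : AnalyticAt ℂ f 0) (c : ℂ) :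
    pairing ξ (c • f) 0 = c * pairing ξ f 0 := by
  simp only [pairing_eq_tsum_finsupp, taylorCoeff_smul hf]
  rw [← tsum_mul_left]
  exact tsum_congr fun α => by ring

theorem normSqOn_smul (D : Set (Cn n)) (c : ℂ) (f : Cn n → ℂ) :
    normSqOn D (c • f) = ‖c‖ₑ ^ 2 * normSqOn D f := by
  simp only [normSqOn, Pi.smul_apply, enorm_smul, mul_pow]
  exact lintegral_const_mul' _ _ (by finiteness)

/-- Functions in the unit ball of `A²(D)` are uniformly bounded near the origin, so the Cauchy
estimates dominate the pairing. -/
theorem bergmanKernel_ne_top {ξ : (Fin n → ℕ) → ℂ} (hξ : ξ ∈ ellOne n) {D : Set (Cn n)}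
    (hD : IsOpen D) (h0 : (0 : Cn n) ∈ D) : bergmanKernel ξ D 0 ≠ ∞ := by
  obtain ⟨r, hr, hrD⟩ := Metric.isOpen_iff.1 hD 0 h0
  obtain ⟨M, hM⟩ := exists_bound_of_normSqOn_le (half_pos hr) (z₀ := 0) (D := D)
    (by rwa [mul_div_cancel₀ _ two_ne_zero]) ENNReal.one_ne_top
  have hball : Metric.ball (0 : Cn n) (r / 2) ⊆ D :=
    (Metric.ball_subset_ball (half_le_self hr.le)).trans hrD
  have hr4 : 0 < r / 4 := by positivity
  let C : ℝ := ∑' α : Fin n →₀ ℕ, ‖ξ α‖ * (r / 4)⁻¹ ^ α.degree * M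
  have hs := (summable_of_mem_ellOne hξ (inv_pos.2 hr4)).mul_right M
  refine ne_top_of_le_ne_top (ENNReal.ofReal_ne_top (r := C ^ 2)) (iSup₂_le fun f hf => ?_)
  obtain ⟨⟨hfa, -⟩, hf1⟩ := hf
  have hle : ‖pairing ξ f 0‖ ≤ C := by
    rw [pairing_eq_tsum_finsupp]
    refine tsum_of_norm_bounded hs.hasSum fun α => ?_
    rw [norm_mul, mul_assoc, inv_pow, mul_comm _ M, ← div_eq_mul_inv]
    gcongr
    exact norm_taylorCoeff_le hr4 (by linarith) (hfa.mono hball)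
      (fun z hz => hM f hfa hf1 z hz) α
  rw [← ofReal_norm, ← ENNReal.ofReal_pow (norm_nonneg _)]
  gcongr

theorem div_bergmanKernel_le_normSqOn {ξ : (Fin n → ℕ) → ℂ} (hξ : ξ ∈ ellOne n)
    {D : Set (Cn n)} (hD : IsOpen D) (h0 : (0 : Cn n) ∈ D) {f : Cn n → ℂ}
    (hf : f ∈ bergmanSpace D) :
    ‖pairing ξ f 0‖ₑ ^ 2 / bergmanKernel ξ D 0 ≤ normSqOn D f := by
  have hK := bergmanKernel_ne_top hξ hD h0
  have hscale : ∀ c : ℂ, ‖c‖ₑ ^ 2 * normSqOn D f ≤ 1 →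
      ‖c‖ₑ ^ 2 * ‖pairing ξ f 0‖ₑ ^ 2 ≤ bergmanKernel ξ D 0 := by
    intro c hc
    rw [← normSqOn_smul] at hc
    have hmem : c • f ∈ bergmanSpace D :=
      ⟨fun z hz => (hf.1 z hz).const_smul, hc.trans_lt ENNReal.one_lt_top⟩
    have := le_iSup₂ (f := fun f (_ : f ∈ {f | f ∈ bergmanSpace D ∧ normSqOn D f ≤ 1}) =>
      ‖pairing ξ f 0‖ₑ ^ 2) (c • f) ⟨hmem, hc⟩
    rwa [pairing_smul ξ (hf.1 0 h0), enorm_mul, mul_pow] at this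
  -- If the norm is zero, all multiples of `f` remain in the unit ball, and finiteness of the kernel
  -- forces the pairing to vanish. Otherwise `f` is normalised.
  rcases eq_or_ne (normSqOn D f) 0 with hN | hN
  · have hp : ‖pairing ξ f 0‖ₑ ^ 2 = 0 := by
      by_contra hp
      obtain ⟨k, hk⟩ := ENNReal.exists_nat_mul_gt hp hK
      have h1 := hscale k (by simp [hN])
      have hk1 : (k : ℝ≥0∞) ≤ ‖(k : ℂ)‖ₑ ^ 2 := by
        have : ‖(k : ℂ)‖ₑ = k := by
          rw [← ofReal_norm, Complex.norm_natCast, ENNReal.ofReal_natCast]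
        rw [this]
        exact_mod_cast Nat.le_self_pow two_ne_zero k
      exact (hk.trans_le ((mul_le_mul_left hk1 _).trans h1)).false
    simp [hp]
  · refine ENNReal.div_le_of_le_mul ?_
    have hNt : normSqOn D f ≠ ∞ := hf.2.ne
    have hNp : 0 < (normSqOn D f).toReal := ENNReal.toReal_pos hN hNt
    have hc : ‖(((√(normSqOn D f).toReal)⁻¹ : ℝ) : ℂ)‖ₑ ^ 2 = (normSqOn D f)⁻¹ := by
      rw [← ofReal_norm, Complex.norm_real, Real.norm_of_nonneg (by positivity),
        ← ENNReal.ofReal_pow (by positivity), inv_pow, Real.sq_sqrt hNp.le,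
        ENNReal.ofReal_inv_of_pos hNp, ENNReal.ofReal_toReal hNt]
    have h1 := hscale _ (by rw [hc, ENNReal.inv_mul_cancel hN hNt])
    rw [hc] at h1
    calc _ = normSqOn D f * ((normSqOn D f)⁻¹ * ‖pairing ξ f 0‖ₑ ^ 2) := by
          rw [← mul_assoc, ENNReal.mul_inv_cancel hN hNt, one_mul]
      _ ≤ _ := by gcongr

theorem bergmanThreshold_le_minimalL2 {D : Set (Cn n)} (hD : IsOpen D) (h0 : (0 : Cn n) ∈ D)
    {F : Cn n → ℂ} (hF : AnalyticAt ℂ F 0) (I : Ideal (HolGerm n)) :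
    bergmanThreshold F I D ≤ minimalL2 F I D := by
  refine iSup₂_le fun ξ hξ => le_iInf₂ fun f hf => ?_
  have h1 := hξ.2.1 _ hf.2
  rw [pairing_sub hξ.1 (hf.1.1 0 h0) hF, sub_eq_zero] at h1
  rw [← h1]
  exact div_bergmanKernel_le_normSqOn hξ.1 hD h0 hf.1

/-! ### Separation in the space of formal power series -/

/-- A neighbourhood of zero on which `|l| < 1` restricts finitely many coordinates only. It contains
the whole subspace where these vanish, and a linear form bounded on a subspace is zero there. -/
theorem exists_finset_eq_sum_of_continuous {ι : Type*} [DecidableEq ι]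
    (l : StrongDual ℂ (ι → ℂ)) :
    ∃ T : Finset ι, ∀ x, l x = ∑ i ∈ T, x i * l (Pi.single i 1) := by
  have h : l ⁻¹' Metric.ball 0 1 ∈ 𝓝 (0 : ι → ℂ) :=
    l.continuous.continuousAt (by simpa using Metric.ball_mem_nhds (0 : ℂ) one_pos)
  rw [nhds_pi, Filter.mem_pi] at h
  obtain ⟨I, hI, t, ht, hsub⟩ := h
  have hzero : ∀ x : ι → ℂ, (∀ i ∈ I, x i = 0) → l x = 0 := by
    intro x hx
    by_contra hne
    have h1 : (l x)⁻¹ • x ∈ I.pi t := fun i hi => by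
      simpa [hx i hi] using mem_of_mem_nhds (ht i)
    have h2 := hsub h1
    simp [hne] at h2
  refine ⟨hI.toFinset, fun x => ?_⟩
  have h1 := hzero (x - ∑ i ∈ hI.toFinset, x i • Pi.single i 1) fun j hj => by
    rw [Pi.sub_apply, Finset.sum_apply, Finset.sum_eq_single j]
    · simp
    · intro i _ hij
      simp [hij.symm]
    · intro h
      exact absurd (hI.mem_toFinset.2 hj) h
  rw [map_sub, map_sum, sub_eq_zero] at h1
  simpa using h1

/-- The Taylor coefficients at the origin. -/
def jet (f : Cn n → ℂ) : (Fin n →₀ ℕ) → ℂ := fun α => taylorCoeff α f 0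

theorem jet_add {f g : Cn n → ℂ} (hf : AnalyticAt ℂ f 0) (hg : AnalyticAt ℂ g 0) :
    jet (f + g) = jet f + jet g := funext fun α => taylorCoeff_add hf hg α

theorem jet_smul {f : Cn n → ℂ} (hf : AnalyticAt ℂ f 0) (c : ℂ) :
    jet (c • f) = c • jet f := funext fun α => taylorCoeff_smul hf c α

theorem jet_zero : jet (0 : Cn n → ℂ) = 0 := by
  have := jet_smul (f := (0 : Cn n → ℂ)) analyticAt_const 0
  rwa [smul_zero, zero_smul] at this

/-- The functional involves finitely many coefficients, so `ξ` has finite support and meets every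
summability condition. -/
theorem exists_pairing_eq (l : StrongDual ℂ ((Fin n →₀ ℕ) → ℂ)) :
    ∃ ξ ∈ ellOne n, ∀ f : Cn n → ℂ, pairing ξ f 0 = l (jet f) := by
  obtain ⟨T, hT⟩ := exists_finset_eq_sum_of_continuous l
  let e : (Fin n →₀ ℕ) ≃ (Fin n → ℕ) := Finsupp.equivFunOnFinite
  let ξ : (Fin n → ℕ) → ℂ := fun α => if e.symm α ∈ T then l (Pi.single (e.symm α) 1) else 0
  have hξ : ∀ α : Fin n →₀ ℕ, ξ α = if α ∈ T then l (Pi.single α 1) else 0 := by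
    intro α
    have : e.symm α = α := e.symm_apply_apply α
    simp only [ξ, this]
  refine ⟨ξ, fun ρ _ => ?_, fun f => ?_⟩
  · refine summable_of_ne_finset_zero (s := T.map e.toEmbedding) fun α hα => ?_
    have : e.symm α ∉ T := fun h => hα (Finset.mem_map.2 ⟨_, h, e.apply_symm_apply α⟩)
    simp [ξ, this]
  · rw [pairing_eq_tsum_finsupp, hT, tsum_eq_sum (s := T)]
    · refine Finset.sum_congr rfl fun α hα => ?_
      rw [hξ, if_pos hα, mul_comm]
      rfl
    · intro α hα
      rw [hξ, if_neg hα, zero_mul]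

theorem normSqOn_convexCombination_le {D : Set (Cn n)} (hD : IsOpen D) {f g : Cn n → ℂ}
    (hf : AnalyticOnNhd ℂ f D) {B : ℝ≥0∞} (hfB : normSqOn D f ≤ B) (hgB : normSqOn D g ≤ B)
    {a b : ℝ} (ha : 0 ≤ a) (hb : 0 ≤ b) (hab : a + b = 1) :
    normSqOn D ((a : ℂ) • f + (b : ℂ) • g) ≤ B := by
  have hm : AEMeasurable (fun z => ENNReal.ofReal a * ‖f z‖ₑ ^ 2) (volume.restrict D) :=
    ((hf.continuousOn.aemeasurable hD.measurableSet).enorm.pow_const 2).const_mul _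
  have hle : ∀ z, ‖((a : ℂ) • f + (b : ℂ) • g) z‖ₑ ^ 2 ≤
      ENNReal.ofReal a * ‖f z‖ₑ ^ 2 + ENNReal.ofReal b * ‖g z‖ₑ ^ 2 := by
    intro z
    simp only [← ofReal_norm]
    rw [← ENNReal.ofReal_pow (norm_nonneg _), ← ENNReal.ofReal_pow (norm_nonneg _),
      ← ENNReal.ofReal_pow (norm_nonneg _), ← ENNReal.ofReal_mul ha, ← ENNReal.ofReal_mul hb,
      ← ENNReal.ofReal_add (by positivity) (by positivity)]
    refine ENNReal.ofReal_le_ofReal ?_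
    have h1 : ‖((a : ℂ) • f + (b : ℂ) • g) z‖ ≤ a * ‖f z‖ + b * ‖g z‖ := by
      refine (norm_add_le _ _).trans_eq ?_
      simp [abs_of_nonneg ha, abs_of_nonneg hb]
    obtain rfl : b = 1 - a := by linarith
    calc _ ≤ (a * ‖f z‖ + (1 - a) * ‖g z‖) ^ 2 := by gcongr
      _ ≤ _ := by nlinarith [mul_nonneg (mul_nonneg ha hb) (sq_nonneg (‖f z‖ - ‖g z‖))]
  calc _ ≤ ∫⁻ z in D, (ENNReal.ofReal a * ‖f z‖ₑ ^ 2 + ENNReal.ofReal b * ‖g z‖ₑ ^ 2) :=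
        lintegral_mono hle
    _ = ENNReal.ofReal a * normSqOn D f + ENNReal.ofReal b * normSqOn D g := by
        rw [lintegral_add_left' hm, lintegral_const_mul' _ _ ENNReal.ofReal_ne_top,
          lintegral_const_mul' _ _ ENNReal.ofReal_ne_top]
        rfl
    _ ≤ ENNReal.ofReal a * B + ENNReal.ofReal b * B := by gcongr
    _ = B := by
        rw [← add_mul, ← ENNReal.ofReal_add ha hb, hab, ENNReal.ofReal_one, one_mul]

/-- The jets of `f + g` with `‖f‖²_D ≤ B` and `(g, o) ∈ I`. -/
def jetSet (D : Set (Cn n)) (I : Ideal (HolGerm n)) (B : ℝ≥0∞) : Set ((Fin n →₀ ℕ) → ℂ) :=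
  {x | ∃ f g, AnalyticOnNhd ℂ f D ∧ normSqOn D f ≤ B ∧ GermMem I g ∧ x = jet f + jet g}

theorem convex_jetSet {D : Set (Cn n)} (hD : IsOpen D) (h0 : (0 : Cn n) ∈ D)
    (I : Ideal (HolGerm n)) (B : ℝ≥0∞) : Convex ℝ (jetSet D I B) := by
  rintro _ ⟨f, g, hf, hfB, hg, rfl⟩ _ ⟨f', g', hf', hfB', hg', rfl⟩ a b ha hb hab
  have hfa := hf 0 h0
  have hfa' := hf' 0 h0
  refine ⟨(a : ℂ) • f + (b : ℂ) • f', (a : ℂ) • g + (b : ℂ) • g',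
    fun z hz => ((hf z hz).const_smul).add ((hf' z hz).const_smul),
    normSqOn_convexCombination_le hD hf hfB hfB' ha hb hab,
    (hg.const_smul _).add (hg'.const_smul _), ?_⟩
  rw [jet_add hfa.const_smul hfa'.const_smul,
    jet_add (hg.const_smul _).1 (hg'.const_smul _).1, jet_smul hfa, jet_smul hfa', jet_smul hg.1,
    jet_smul hg'.1]
  funext α
  simp
  ring

theorem smul_mem_jetSet {D : Set (Cn n)} (h0 : (0 : Cn n) ∈ D) {I : Ideal (HolGerm n)}
    {B : ℝ≥0∞} {x : (Fin n →₀ ℕ) → ℂ} (hx : x ∈ jetSet D I B) {c : ℂ} (hc : ‖c‖ = 1) :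
    c • x ∈ jetSet D I B := by
  obtain ⟨f, g, hf, hfB, hg, rfl⟩ := hx
  refine ⟨c • f, c • g, fun z hz => (hf z hz).const_smul, ?_, hg.const_smul c, ?_⟩
  · rw [normSqOn_smul, ← ofReal_norm, hc]
    simpa using hfB
  · rw [jet_smul (hf 0 h0), jet_smul hg.1, smul_add]

theorem jet_mem_closure_jetSet {D : Set (Cn n)} (hD : IsOpen D) (h0 : (0 : Cn n) ∈ D)
    (F : Cn n → ℂ) (I : Ideal (HolGerm n)) (hB : bergmanThreshold F I D ≠ ∞) :
    jet F ∈ closure (jetSet D I (bergmanThreshold F I D)) := by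
  set B := bergmanThreshold F I D with hBdef
  by_contra hF
  obtain ⟨l, u, hlS, hlF⟩ := RCLike.geometric_hahn_banach_closed_point (𝕜 := ℂ)
    (convex_jetSet hD h0 I B).closure isClosed_closure hF
  have hnorm : ∀ x ∈ jetSet D I B, ‖l x‖ < u := by
    intro x hx
    -- The set is circled: rotating `x` upgrades the bound on the real part of `l x` to one on its
    -- modulus.
    obtain ⟨c, hc, hcl⟩ := RCLike.exists_norm_eq_mul_self (l x)
    have h1 := hlS _ (subset_closure (smul_mem_jetSet h0 hx hc))
    rw [map_smul, smul_eq_mul, ← hcl] at h1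
    simpa using h1
  have hmem : ∀ f g, AnalyticOnNhd ℂ f D → normSqOn D f ≤ B → GermMem I g →
      jet f + jet g ∈ jetSet D I B := fun f g h1 h2 h3 => ⟨f, g, h1, h2, h3, rfl⟩
  have hn0 : normSqOn D (0 : Cn n → ℂ) ≤ B := by simp [normSqOn]
  have hu : 0 < u := (norm_nonneg _).trans_lt
    (hnorm _ (hmem 0 0 (fun _ _ => analyticAt_const) hn0 GermMem.zero))
  have hlg : ∀ g, GermMem I g → l (jet g) = 0 := by
    intro g hg
    by_contra hne
    -- The scaling is chosen so that `l` takes the value `u` exactly, contradicting the strict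
    -- bound.
    have h1 := hnorm _ (hmem 0 (((u : ℂ) / l (jet g)) • g) (fun _ _ => analyticAt_const) hn0
      (hg.const_smul _))
    rw [jet_zero, zero_add, jet_smul hg.1, map_smul, smul_eq_mul, div_mul_cancel₀ _ hne,
      Complex.norm_real, Real.norm_of_nonneg hu.le] at h1
    exact h1.false
  obtain ⟨ξ, hξ1, hξ⟩ := exists_pairing_eq l
  have hlF' : u < ‖l (jet F)‖ := hlF.trans_le (RCLike.re_le_norm _)
  have hξI : ξ ∈ ellIdeal I := by
    refine ⟨hξ1, fun g hg => by rw [hξ, hlg g hg], ?_⟩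
    rintro rfl
    have h1 := hξ F
    simp only [pairing, Pi.zero_apply, zero_mul, tsum_zero] at h1
    rw [← h1, norm_zero] at hlF'
    exact hlF'.not_gt hu
  have h1 : ‖pairing ξ F 0‖ₑ ^ 2 / bergmanKernel ξ D 0 ≤ B :=
    le_iSup₂ (f := fun ξ (_ : ξ ∈ ellIdeal I) => ‖pairing ξ F 0‖ₑ ^ 2 / bergmanKernel ξ D 0) ξ hξI
  rw [ENNReal.div_le_iff_le_mul (Or.inr hB) (Or.inl (bergmanKernel_ne_top hξ1 hD h0))] at h1
  -- For `f` in the unit ball, `√B • f` has squared norm at most `B`, so its jet obeys the bound by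
  -- `u`.
  have h2 : B * bergmanKernel ξ D 0 ≤ ENNReal.ofReal (u ^ 2) := by
    rw [bergmanKernel]
    simp only [ENNReal.mul_iSup]
    refine iSup₂_le fun f hf => ?_
    obtain ⟨⟨hfa, -⟩, hf1⟩ := hf
    have hc : ‖((√B.toReal : ℝ) : ℂ)‖ₑ ^ 2 = B := by
      rw [← ofReal_norm, Complex.norm_real, Real.norm_of_nonneg (by positivity),
        ← ENNReal.ofReal_pow (by positivity), Real.sq_sqrt ENNReal.toReal_nonneg,
        ENNReal.ofReal_toReal hB]
    have h3 := hnorm _ (hmem (((√B.toReal : ℝ) : ℂ) • f) 0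
      (fun z hz => (hfa z hz).const_smul) (by
        rw [normSqOn_smul, hc]
        exact mul_le_of_le_one_right' hf1) GermMem.zero)
    rw [jet_zero, add_zero, jet_smul (hfa 0 h0), map_smul, smul_eq_mul, ← hξ f] at h3
    calc _ = ‖((√B.toReal : ℝ) : ℂ) * pairing ξ f 0‖ₑ ^ 2 := by rw [enorm_mul, mul_pow, hc]
      _ ≤ _ := by
        rw [← ofReal_norm, ← ENNReal.ofReal_pow (norm_nonneg _)]
        gcongr
  have h3 := h1.trans h2
  rw [hξ, ← ofReal_norm, ← ENNReal.ofReal_pow (norm_nonneg _),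
    ENNReal.ofReal_le_ofReal_iff (by positivity)] at h3
  exact ((pow_lt_pow_left₀ hlF' hu.le two_ne_zero).trans_le h3).false

/-! ### Passage to the limit and equality of the thresholds -/

/-- For each finite set of exponents, the truncated jets of elements of `I` form a subspace of a
finite-dimensional space, hence a closed one. So the truncation of the limit is attained by an
element of `I`, and `germMem_of_forall_finset` applies. -/
theorem germMem_of_tendsto_jet {I : Ideal (HolGerm n)} {g : ℕ → Cn n → ℂ}
    (hg : ∀ k, GermMem I (g k)) {f : Cn n → ℂ} (hf : AnalyticAt ℂ f 0)
    (h : Tendsto (fun k => jet (g k)) atTop (𝓝 (jet f))) : GermMem I f := by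
  refine germMem_of_forall_finset hf fun T => ?_
  let W : Submodule ℂ (T → ℂ) :=
    { carrier := {v | ∃ g, GermMem I g ∧ ∀ α : T, taylorCoeff (α : Fin n →₀ ℕ) g 0 = v α}
      zero_mem' := ⟨0, GermMem.zero, fun α => congrFun jet_zero _⟩
      add_mem' := by
        rintro v w ⟨g, hg, hgv⟩ ⟨g', hg', hgw⟩
        exact ⟨g + g', hg.add hg', fun α => by
          rw [taylorCoeff_add hg.1 hg'.1, hgv, hgw, Pi.add_apply]⟩
      smul_mem' := by
        rintro c v ⟨g, hg, hgv⟩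
        exact ⟨c • g, hg.const_smul c, fun α => by
          rw [taylorCoeff_smul hg.1, hgv, Pi.smul_apply, smul_eq_mul]⟩ }
  have hW : IsClosed (W : Set (T → ℂ)) := W.closed_of_finiteDimensional
  have hmem : (fun α : T => jet f α) ∈ W := by
    refine hW.mem_of_tendsto (f := fun k (α : T) => jet (g k) α) (b := atTop) ?_
      (Eventually.of_forall fun k => ⟨g k, hg k, fun α => rfl⟩)
    exact tendsto_pi_nhds.2 fun α => tendsto_pi_nhds.1 h α
  obtain ⟨g', hg', h'⟩ := hmem
  exact ⟨g', hg', fun α hα => h' ⟨α, hα⟩⟩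

theorem minimalL2_le_bergmanThreshold {D : Set (Cn n)} (hD : IsOpen D) (h0 : (0 : Cn n) ∈ D)
    {F : Cn n → ℂ} (hF : AnalyticAt ℂ F 0) (I : Ideal (HolGerm n)) :
    minimalL2 F I D ≤ bergmanThreshold F I D := by
  rcases eq_or_ne (bergmanThreshold F I D) ∞ with hB | hB
  · rw [hB]
    exact le_top
  obtain ⟨x, hx, hxlim⟩ :=
    mem_closure_iff_seq_limit.1 (jet_mem_closure_jetSet hD h0 F I hB)
  choose f g hf hfB hg hx using hx
  obtain ⟨φ, f', hφ, hf', hfB', hlim⟩ :=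
    exists_subseq_tendsto_of_normSqOn_le hD h0 hB f hf hfB
  have hf0 := hf' 0 h0
  refine iInf₂_le_of_le f' ⟨⟨hf', hfB'.trans_lt hB.lt_top⟩, ?_⟩ hfB'
  -- Since `x k` is the sum of the jets of `f k` and `g k`, the jet of `-g (φ k)` is that of `f (φ
  -- k)` minus `x (φ k)`, which tends to the jet of `f' - F`.
  refine germMem_of_tendsto_jet (g := fun k => (-1 : ℂ) • g (φ k))
    (fun k => (hg _).const_smul _) (hf0.sub hF) (tendsto_pi_nhds.2 fun α => ?_)
  have h1 : Tendsto (fun k => jet (f (φ k)) α - x (φ k) α) atTop (𝓝 (jet f' α - jet F α)) :=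
    (hlim α).sub ((tendsto_pi_nhds.1 hxlim α).comp hφ.tendsto_atTop)
  have h2 : jet (f' - F) α = jet f' α - jet F α := taylorCoeff_sub hf0 hF α
  rw [h2]
  refine h1.congr fun k => ?_
  rw [hx, jet_smul (hg _).1]
  simp

/-- The threshold given by `ξ`-Bergman kernels is the minimal `L²` integral, for every ideal. -/
theorem bergmanThreshold_eq_minimalL2 {D : Set (Cn n)} (hD : IsOpen D) (h0 : (0 : Cn n) ∈ D)
    {F : Cn n → ℂ} (hF : AnalyticAt ℂ F 0) (I : Ideal (HolGerm n)) :
    bergmanThreshold F I D = minimalL2 F I D :=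
  (bergmanThreshold_le_minimalL2 hD h0 hF I).antisymm (minimalL2_le_bergmanThreshold hD h0 hF I)

theorem IsAdmissible.thresholdB_eq_thresholdC {D : Set (Cn n)} {φ : Cn n → EReal} {F : Cn n → ℂ}
    (h : IsAdmissible D φ F) : thresholdB D φ F = thresholdC D φ F :=
  bergmanThreshold_eq_minimalL2 h.pseudoconvex.isOpen h.zero_mem (h.holomorphic 0 h.zero_mem) _

end StrongOpenness

end

theorem mainTheorem2 (n : ℕ) :
    (∀ (D : Set (StrongOpenness.Cn n)) (φ : StrongOpenness.Cn n → EReal)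
        (F : StrongOpenness.Cn n → ℂ), StrongOpenness.IsAdmissible D φ F →
      StrongOpenness.thresholdB D φ F = StrongOpenness.thresholdC D φ F ∧
      (StrongOpenness.EffectiveWith (StrongOpenness.thresholdB D φ F) D φ F ↔
        StrongOpenness.EffectiveWith (StrongOpenness.thresholdC D φ F) D φ F)) ∧
    (StrongOpenness.BergmanEffectiveness n ↔ StrongOpenness.MinimalL2Effectiveness n) := by
  have h : ∀ (D : Set (StrongOpenness.Cn n)) (φ : StrongOpenness.Cn n → EReal)
      (F : StrongOpenness.Cn n → ℂ), StrongOpenness.IsAdmissible D φ F →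
      (StrongOpenness.EffectiveWith (StrongOpenness.thresholdB D φ F) D φ F ↔
        StrongOpenness.EffectiveWith (StrongOpenness.thresholdC D φ F) D φ F) := by
    intro D φ F hadm
    rw [hadm.thresholdB_eq_thresholdC]
  refine ⟨fun D φ F hadm => ⟨hadm.thresholdB_eq_thresholdC, h D φ F hadm⟩, ?_⟩
  exact ⟨fun H D φ F hadm => (h D φ F hadm).1 (H D φ F hadm),
    fun H D φ F hadm => (h D φ F hadm).2 (H D φ F hadm)⟩
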